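/- Let $f_1,f_2,f_3,f_4:\mathbb R\to\mathbb R$ be functions with affine derivatives $f_i'(t)=a_it+b_i$ (indices are taken mod $4$). Identify $T^*\mathbb R$ with $\mathbb C$ by $(x,y)\mapsto x+iy$, and for $\epsilon>0$ let $L_i^\epsilon=\{x+iy : y=\epsilon f_i'(x)\}$ be the graph of $\epsilon\,df_i$. Assume that $L_i^\epsilon\cap L_j^\epsilon\ne\emptyset$ and $L_i^\epsilon\ne L_j^\epsilon$ for $i\neq j$. Let $x_i^\epsilon$ be the intersection point of $L_i^\epsilon$ and $L_{i+1}^\epsilon$, and let $p_i$ be the critical point of $f_{i+1}-f_i$. Assume that $x_1^\epsilon,x_2^\epsilon,x_3^\epsilon,x_4^\epsilon$ are, in counterclockwise order, the vertices of a (nondegenerate) convex quadrilateral. Let $w_\epsilon$ be the Schwarz–Christoffel map of this quadrilateral, i.e. a conformal map of the open upper half plane onto the interior of the quadrilateral, extended continuously to the boundary (including $\infty$), with $w_\epsilon(1)=x_1^\epsilon$, $w_\epsilon(\infty)=x_2^\epsilon$, $w_\epsilon(0)=x_3^\epsilon$; let $z_{4,\epsilon}\in(0,1)$ be the point with $w_\epsilon(z_{4,\epsilon})=x_4^\epsilon$.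 The intervals $(z_{4,\epsilon},1)$, $(1,\infty)$, $(-\infty,0)$, $(0,z_{4,\epsilon})$ are mapped into $L_1^\epsilon$, $L_2^\epsilon$, $L_3^\epsilon$, $L_4^\epsilon$, respectively. A gradient tree for $(f_i),(p_i)$ consists of a metric ribbon tree with four exterior vertices $v_1,\dots,v_4$ in counterclockwise order on the unit circle, all of whose interior vertices have at least three edges, and a map $I$ from it to $\mathbb R$ that is continuous at the interior vertices, such that: on the exterior edge at $v_i$, identified with $(-\infty,0]$, $\frac{dI}{dt}=-(f_{i+1}-f_i)'(I)$ and $I(t)\to p_i$ as $t\to-\infty$; on an interior edge of length $l>0$, identified with $[0,l]$, $\frac{dI}{dt}=-(f_k-f_j)'(I)$, where $j<k$ and the edge, oriented in the direction of increasing $t$, has the region $D_j$ on its left and the region $D_k$ on its right. Here $D_i$ is the component of the complement of the tree in the disk between $v_{i-1}$ and $v_i$. (Such a tree has at most one interior edge.) 1. If $(p_3-p_1)(p_4-p_2)>0$, then there is $l>0$ such that gradient trees exist, every gradient tree has exactly one interior edge, its length is $l$, and $$\log z_{4,\epsilon}\sim-\frac{\pi l}{\epsilon}\qquad(\epsilon\to+0).$$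 2. If $(p_3-p_1)(p_4-p_2)<0$, then there is $l>0$ such that gradient trees exist, every gradient tree has exactly one interior edge, its length is $l$, and $$\log(1-z_{4,\epsilon})\sim-\frac{\pi l}{\epsilon}\qquad(\epsilon\to+0).$$ -/

import Mathlib

open Filter Topology Set
open scoped Asymptotics

/-- A function on `ℝ` whose derivative is affine, i.e. `graph(df)` is an affine Lagrangian section
of `T^*ℝ`. -/
def HasAffineDerivative (f : ℝ → ℝ) : Prop :=
  ∃ a b : ℝ, ∀ t : ℝ, HasDerivAt f (a * t + b) t

/-- `graph(ε df)`, with `T^*ℝ = ℝ²` identified with `ℂ` through `(x, y) ↦ x + i y`. -/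
def lagrangian (f : ℝ → ℝ) (ε : ℝ) : Set ℂ :=
  {z | z.im = ε * deriv f z.re}

/-- The four points are, in this order, the vertices of a (nondegenerate) convex quadrilateral
described counterclockwise: the closed polygon turns strictly to the left at each vertex.
(Four left turns, each by an angle in `(0, π)`, add up to exactly one full turn.) -/
def IsConvexQuadrilateralCCW (x : Fin 4 → ℂ) : Prop :=
  ∀ i : Fin 4,
    0 < (x (i + 1) - x i).re * (x (i + 2) - x (i + 1)).im
      - (x (i + 1) - x i).im * (x (i + 2) - x (i + 1)).re

/-- `w` is the Schwarz-Christoffel map from the upper half plane to the quadrilateral with vertices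
`x 0, x 1, x 2, x 3` and side lines `L 0, L 1, L 2, L 3` (`x i ∈ L i ∩ L (i + 1)`), normalised by
the marked points `1, ∞, 0, ζ` with `ζ ∈ (0, 1)`: a conformal map of the open half plane onto the
interior of the quadrilateral, continuous up to the boundary (including `∞`), which sends the
marked points to the vertices and the open boundary intervals between them into the side lines. -/
structure IsSchwarzChristoffelMap (L : Fin 4 → Set ℂ) (x : Fin 4 → ℂ) (ζ : ℝ) (w : ℂ → ℂ) :
    Prop where
  zeta_mem : ζ ∈ Ioo (0 : ℝ) 1
  holomorphic : DifferentiableOn ℂ w {z | 0 < z.im}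
  bijective : BijOn w {z | 0 < z.im} (interior (convexHull ℝ (range x)))
  continuous : ContinuousOn w {z | 0 ≤ z.im}
  map_one : w 1 = x 0
  map_infty : Tendsto w (Bornology.cobounded ℂ ⊓ 𝓟 {z | 0 ≤ z.im}) (𝓝 (x 1))
  map_zero : w 0 = x 2
  map_zeta : w (ζ : ℂ) = x 3
  side_zero : ∀ t ∈ Ioo ζ 1, w (t : ℂ) ∈ L 0
  side_one : ∀ t ∈ Ioi (1 : ℝ), w (t : ℂ) ∈ L 1
  side_two : ∀ t ∈ Iio (0 : ℝ), w (t : ℂ) ∈ L 2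
  side_three : ∀ t ∈ Ioo 0 ζ, w (t : ℂ) ∈ L 3

/-- Metric ribbon trees with four exterior vertices `v 0, v 1, v 2, v 3` in counterclockwise order
on the unit circle. Let `D i` be the complementary region of the disk between `v (i - 1)` and
`v i`. Every vertex in the interior of the disk has at least three edges, so up to isotopy there is
either no interior edge, or exactly one, which has `D 0` on its left and `D 2` on its right (it runs
from the vertex joined to `v 0, v 1` to the vertex joined to `v 2, v 3`), or `D 1` on its left and
`D 3` on its right (it runs from the vertex joined to `v 1, v 2` to the one joined to `v 3, v 0`).
The number `l` is the length of the interior edge. -/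
inductive MetricRibbonTree : Type
  | star : MetricRibbonTree
  | edge02 (l : ℝ) (hl : 0 < l) : MetricRibbonTree
  | edge13 (l : ℝ) (hl : 0 < l) : MetricRibbonTree

/-- The set of the lengths of the interior edges. -/
def MetricRibbonTree.interiorLengths : MetricRibbonTree → Set ℝ
  | .star => ∅
  | .edge02 l _ => {l}
  | .edge13 l _ => {l}

/-- `γ` solves `dγ/dt = - grad h` on `s` (one-sided derivatives at the end points of `s`). -/
def IsGradientCurve (h : ℝ → ℝ) (s : Set ℝ) (γ : ℝ → ℝ) : Prop :=
  ∀ t ∈ s, HasDerivWithinAt γ (-deriv h (γ t)) s t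

/-- `(T, I)` is a gradient tree for the functions `f i` and the critical points `p i` of
`f (i + 1) - f i`. The map `I` is given by its restrictions `Iext i` to the exterior edges, each
identified with `(-∞, 0]` so that `v i` sits at `-∞`, and by its restriction `Iint` to the interior
edge (if there is one), identified with `[0, l]`; only the values there matter. Along an edge with
region `D i` on its left and `D j` on its right, `I` follows `- grad (f j - f i)`; the restrictions
agree at the interior vertices. -/
def IsGradientTree (f : Fin 4 → ℝ → ℝ) (p : Fin 4 → ℝ) (T : MetricRibbonTree)
    (Iext : Fin 4 → ℝ → ℝ) (Iint : ℝ → ℝ) : Prop :=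
  (∀ i, IsGradientCurve (fun q => f (i + 1) q - f i q) (Iic 0) (Iext i) ∧
      Tendsto (Iext i) atBot (𝓝 (p i))) ∧
    match T with
    | .star => ∀ i j, Iext i 0 = Iext j 0
    | .edge02 l _ =>
        IsGradientCurve (fun q => f 2 q - f 0 q) (Icc 0 l) Iint ∧
          Iext 0 0 = Iint 0 ∧ Iext 1 0 = Iint 0 ∧ Iext 2 0 = Iint l ∧ Iext 3 0 = Iint l
    | .edge13 l _ =>
        IsGradientCurve (fun q => f 3 q - f 1 q) (Icc 0 l) Iint ∧
          Iext 1 0 = Iint 0 ∧ Iext 2 0 = Iint 0 ∧ Iext 3 0 = Iint l ∧ Iext 0 0 = Iint l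

/-- There is a gradient tree, and every gradient tree has exactly one interior edge, of length
`l`. -/
def IsInteriorEdgeLength (f : Fin 4 → ℝ → ℝ) (p : Fin 4 → ℝ) (l : ℝ) : Prop :=
  (∃ T Iext Iint, IsGradientTree f p T Iext Iint) ∧
    ∀ T Iext Iint, IsGradientTree f p T Iext Iint → T.interiorLengths = {l}

/-!
The theorem compares two notions of width of a thin quadrilateral of height of order `ε`, and the
proof is a length-area argument carried out in both directions; no formula for the
Schwarz-Christoffel map is used.

After a rotation by `π` and a cyclic renumbering of the vertices one may assume `p 0 < p 2` and
`p 1 < p 3` (`IsLeftRightQuadrilateral`). Convexity then puts the vertices `0, 1` to the left of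
`2, 3`. Over the middle region, between `α = max (p 0) (p 1)` and `β = min (p 2) (p 3)`, the
quadrilateral is bounded by the line `0` above and the line `2` below, at distance
`ε * gap`, where `gap = f₀' - f₂'`. The number `l` is `∫ 1 / gap` over `[α, β]`.

* *Gradient trees.* On an exterior edge where `f (i + 1) - f i` is convex the curve is constant.
  This fixes one end of the interior edge at `α` and the other one at `β`, so this edge is the
  flow line of `I' = gap I` from `α` to `β`, and `l` is its travel time. The other combinatorial
  types would force `α = β` or a curve running against the flow (`isInteriorEdgeLength`).
* *Modulus.* The logarithm maps the half plane to the strip `0 < Im < π`, and the sides `0` and `2`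
  of the quadrilateral correspond to the segment `(log ζ, 0)` of the bottom side and to the top side.
  If a test function on the target of a conformal map has prescribed boundary values at the ends
  of the vertical segments foliating the source, its Dirichlet energy is at least the conductance
  of the source (`length_area_inequality`). With the cut-off height function on the strip and the
  vertical segments over the middle region this yields `π l / ε ≤ -log ζ + O(1)`
  (`exists_lower_bound`). With the cut-off interpolation between the lines `2` and `0` on the
  quadrilateral and the vertical segments of the strip, it yields
  `-log ζ ≤ π (l + η) / ε + O(ε)` for each `η > 0` (`exists_upper_bound`).

The cyclic renumbering replaces `ζ` by `1 - ζ`, through a Möbius transformation of the half plane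
(`IsSchwarzChristoffelMap.shift`); this is the difference between the two cases.
-/

open MeasureTheory

/-! ### The length-area inequality -/

theorem Complex.lintegral_eq_lintegral_re_im {F : ℂ → ENNReal} (hF : AEMeasurable F) :
    ∫⁻ z, F z = ∫⁻ x : ℝ, ∫⁻ y : ℝ, F ⟨x, y⟩ := by
  have hmp := Complex.volume_preserving_equiv_real_prod.symm
  rw [← hmp.lintegral_comp_emb Complex.measurableEquivRealProd.symm.measurableEmbedding,
    Measure.volume_eq_prod, lintegral_prod]
  · simp
  · exact hF.comp_quasiMeasurePreserving hmp.quasiMeasurePreserving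

theorem ofReal_sq_div_le_lintegral_sq_of_endpoints {W D : ℝ → ℝ} {s t : ℝ} (hst : s < t)
    (hW : ∀ y ∈ Icc s t, HasDerivAt W (D y) y) (hD : ContinuousOn D (Icc s t)) :
    ENNReal.ofReal ((W t - W s) ^ 2 / (t - s)) ≤ ∫⁻ y in Ioc s t, ENNReal.ofReal (D y ^ 2) := by
  have hD' : ContinuousOn D (uIcc s t) := by rwa [uIcc_of_le hst.le]
  have hint : IntervalIntegrable D volume s t := hD'.intervalIntegrable
  have hint2 : IntervalIntegrable (fun y => D y ^ 2) volume s t := (hD'.pow 2).intervalIntegrable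
  have hftc : ∫ y in s..t, D y = W t - W s :=
    intervalIntegral.integral_eq_sub_of_hasDerivAt
      (fun y hy => hW y (by rwa [uIcc_of_le hst.le] at hy)) hint
  rw [← ofReal_integral_eq_lintegral_ofReal, ← intervalIntegral.integral_of_le hst.le]
  · apply ENNReal.ofReal_le_ofReal
    set m := (W t - W s) / (t - s) with hm
    have h0 : 0 < t - s := sub_pos.2 hst
    -- with the mean slope `m`, the pointwise bound `D² ≥ 2 m D - m²` integrates to Cauchy-Schwarz
    have hle : ∫ y in s..t, (2 * m * D y - m ^ 2) ≤ ∫ y in s..t, D y ^ 2 := by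
      refine intervalIntegral.integral_mono_on hst.le
        ((hint.const_mul _).sub intervalIntegrable_const) hint2 fun y _ => ?_
      nlinarith [sq_nonneg (D y - m)]
    rw [intervalIntegral.integral_sub (hint.const_mul _) intervalIntegrable_const,
      intervalIntegral.integral_const_mul, hftc, intervalIntegral.integral_const, smul_eq_mul] at hle
    refine le_trans (le_of_eq ?_) hle
    rw [hm]
    field_simp
    ring
  · exact (intervalIntegrable_iff_integrableOn_Ioc_of_le hst.le).1 hint2
  · exact ae_of_all _ fun y => sq_nonneg _

/-- One-dimensional length-area inequality: a function whose values at the two ends of an interval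
differ by `c₁ - c₀` has energy at least `(c₁ - c₀)² / (b - a)`. -/
theorem ofReal_sq_div_le_lintegral_sq {W D : ℝ → ℝ} {a b c₀ c₁ : ℝ} (hab : a < b)
    (hW : ∀ y ∈ Ioo a b, HasDerivAt W (D y) y) (hD : ContinuousOn D (Ioo a b))
    (h₀ : Tendsto W (𝓝[>] a) (𝓝 c₀)) (h₁ : Tendsto W (𝓝[<] b) (𝓝 c₁)) :
    ENNReal.ofReal ((c₁ - c₀) ^ 2 / (b - a)) ≤ ∫⁻ y in Ioo a b, ENNReal.ofReal (D y ^ 2) := by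
  have hlim : Tendsto (fun q : ℝ × ℝ => ENNReal.ofReal ((W q.2 - W q.1) ^ 2 / (b - a)))
      (𝓝[>] a ×ˢ 𝓝[<] b) (𝓝 (ENNReal.ofReal ((c₁ - c₀) ^ 2 / (b - a)))) :=
    (ENNReal.continuous_ofReal.tendsto _).comp
      ((((h₁.comp tendsto_snd).sub (h₀.comp tendsto_fst)).pow 2).div_const _)
  refine le_of_tendsto hlim ?_
  have hl : ∀ᶠ s in 𝓝[>] a, s ∈ Ioo a ((a + b) / 2) := Ioo_mem_nhdsGT (by linarith)
  have hr : ∀ᶠ t in 𝓝[<] b, t ∈ Ioo ((a + b) / 2) b := Ioo_mem_nhdsLT (by linarith)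
  filter_upwards [hl.prod_mk hr] with q hq
  obtain ⟨⟨hs1, hs2⟩, ht1, ht2⟩ := hq
  have hst : q.1 < q.2 := hs2.trans ht1
  have hsub : Icc q.1 q.2 ⊆ Ioo a b := fun y hy => ⟨hs1.trans_le hy.1, hy.2.trans_lt ht2⟩
  calc ENNReal.ofReal ((W q.2 - W q.1) ^ 2 / (b - a))
      ≤ ENNReal.ofReal ((W q.2 - W q.1) ^ 2 / (q.2 - q.1)) := by
        apply ENNReal.ofReal_le_ofReal
        exact div_le_div_of_nonneg_left (sq_nonneg _) (by linarith) (by linarith)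
    _ ≤ ∫⁻ y in Ioc q.1 q.2, ENNReal.ofReal (D y ^ 2) :=
        ofReal_sq_div_le_lintegral_sq_of_endpoints hst (fun y hy => hW y (hsub hy)) (hD.mono hsub)
    _ ≤ _ := lintegral_mono_set (Ioc_subset_Icc_self.trans hsub)

theorem Complex.lintegral_image_eq {φ : ℂ → ℂ} {U : Set ℂ} (hU : IsOpen U)
    (hφ : DifferentiableOn ℂ φ U) (hinj : InjOn φ U) (F : ℂ → ENNReal) :
    ∫⁻ z in φ '' U, F z = ∫⁻ z in U, ENNReal.ofReal (‖deriv φ z‖ ^ 2) * F (φ z) := by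
  rw [lintegral_image_eq_lintegral_abs_det_fderiv_mul volume hU.measurableSet
    (f' := fun z => (ContinuousLinearMap.toSpanSingleton ℂ (deriv φ z)).restrictScalars ℝ)
    (fun z hz => ?_) hinj]
  · congr 1
    ext z
    congr 2
    simp [ContinuousLinearMap.det, LinearMap.det_restrictScalars, Algebra.norm_complex_eq,
      Complex.normSq_eq_norm_sq]
  · exact ((hφ.differentiableAt (hU.mem_nhds hz)).hasDerivAt.hasFDerivAt.restrictScalars
      ℝ).hasFDerivWithinAt

/-- Test functions for the length-area method: functions on `ℂ` that are affine in the imaginary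
part, with coefficients depending on the real part. -/
def sliceAffine (A B : ℝ → ℝ) (z : ℂ) : ℝ := A z.re + B z.re * z.im

/-- The squared norm of the gradient of `sliceAffine A B`. -/
noncomputable def sliceAffineEnergy (A B : ℝ → ℝ) (z : ℂ) : ℝ :=
  (deriv A z.re + deriv B z.re * z.im) ^ 2 + B z.re ^ 2

theorem hasDerivAt_sliceAffine_comp {A B : ℝ → ℝ} (hA : Differentiable ℝ A)
    (hB : Differentiable ℝ B) {φ : ℝ → ℂ} {φ' : ℂ} {y : ℝ} (hφ : HasDerivAt φ φ' y) :
    HasDerivAt (fun y => sliceAffine A B (φ y))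
      ((deriv A (φ y).re + deriv B (φ y).re * (φ y).im) * φ'.re + B (φ y).re * φ'.im) y := by
  have hre : HasDerivAt (fun y => (φ y).re) φ'.re y :=
    (Complex.reCLM.hasFDerivAt.comp_hasDerivAt y hφ)
  have him : HasDerivAt (fun y => (φ y).im) φ'.im y :=
    (Complex.imCLM.hasFDerivAt.comp_hasDerivAt y hφ)
  have hA' : HasDerivAt (fun y => A (φ y).re) _ y :=
    HasDerivAt.comp y (hA (φ y).re).hasDerivAt hre
  have hB' : HasDerivAt (fun y => B (φ y).re) _ y :=
    HasDerivAt.comp y (hB (φ y).re).hasDerivAt hre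
  exact (hA'.add (hB'.mul him)).congr_deriv (by ring)

/-- Length-area inequality: if a test function has boundary values `c₀` and `c₁` along the images
of the bottom and top ends of the vertical segments foliating `U`, its energy is at least
`(c₁ - c₀)²` times the conductance of `U`. The conformal invariance of the energy enters through
the change of variables formula. -/
theorem length_area_inequality {A B : ℝ → ℝ} (hA : ContDiff ℝ 1 A) (hB : ContDiff ℝ 1 B)
    {α β : ℝ} {a b : ℝ → ℝ} (ha : Continuous a) (hb : Continuous b)
    (hab : ∀ x ∈ Ioo α β, a x < b x) {φ : ℂ → ℂ} {U Ω : Set ℂ}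
    (hUdef : U = {z | z.re ∈ Ioo α β ∧ z.im ∈ Ioo (a z.re) (b z.re)})
    (hφ : DifferentiableOn ℂ φ U) (hinj : InjOn φ U) (hmaps : MapsTo φ U Ω) {c₀ c₁ : ℝ}
    (h₀ : ∀ x ∈ Ioo α β,
      Tendsto (fun y : ℝ => sliceAffine A B (φ ⟨x, y⟩)) (𝓝[>] (a x)) (𝓝 c₀))
    (h₁ : ∀ x ∈ Ioo α β,
      Tendsto (fun y : ℝ => sliceAffine A B (φ ⟨x, y⟩)) (𝓝[<] (b x)) (𝓝 c₁)) :
    ∫⁻ x in Ioo α β, ENNReal.ofReal ((c₁ - c₀) ^ 2 / (b x - a x)) ≤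
      ∫⁻ z in Ω, ENNReal.ofReal (sliceAffineEnergy A B z) := by
  have hU : IsOpen U := by
    rw [hUdef]
    have e : {z : ℂ | z.re ∈ Ioo α β ∧ z.im ∈ Ioo (a z.re) (b z.re)} =
        ({z | α < z.re} ∩ {z | z.re < β}) ∩ ({z | a z.re < z.im} ∩ {z | z.im < b z.re}) := by
      ext z; simp
    rw [e]
    refine ((isOpen_lt ?_ ?_).inter (isOpen_lt ?_ ?_)).inter
      ((isOpen_lt ?_ ?_).inter (isOpen_lt ?_ ?_)) <;> fun_prop
  have hA' : Continuous (deriv A) := hA.continuous_deriv le_rfl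
  have hB' : Continuous (deriv B) := hB.continuous_deriv le_rfl
  have hAd : Differentiable ℝ A := hA.differentiable one_ne_zero
  have hBd : Differentiable ℝ B := hB.differentiable one_ne_zero
  -- the derivative of the pulled back test function in the vertical direction
  set D : ℂ → ℝ := fun z =>
    (deriv A (φ z).re + deriv B (φ z).re * (φ z).im) * (deriv φ z * Complex.I).re +
      B (φ z).re * (deriv φ z * Complex.I).im with hDdef
  have hφ' : ContinuousOn (deriv φ) U := (hφ.deriv hU).continuousOn
  have hDc : ContinuousOn D U := by
    have h1 : ContinuousOn (fun z => (φ z).re) U := Complex.continuous_re.comp_continuousOn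
      hφ.continuousOn
    have h2 : ContinuousOn (fun z => (φ z).im) U := Complex.continuous_im.comp_continuousOn
      hφ.continuousOn
    have h3 : ContinuousOn (fun z => deriv φ z * Complex.I) U := hφ'.mul continuousOn_const
    exact (((hA'.comp_continuousOn h1).add ((hB'.comp_continuousOn h1).mul h2)).mul
      (Complex.continuous_re.comp_continuousOn h3)).add
      ((hB.continuous.comp_continuousOn h1).mul (Complex.continuous_im.comp_continuousOn h3))
  have hDle : ∀ z, D z ^ 2 ≤ ‖deriv φ z‖ ^ 2 * sliceAffineEnergy A B (φ z) := fun z => by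
    rw [← Complex.normSq_eq_norm_sq, Complex.normSq_apply, sliceAffineEnergy, hDdef]
    simp only [Complex.mul_re, Complex.mul_im, Complex.I_re, Complex.I_im]
    nlinarith [sq_nonneg ((deriv A (φ z).re + deriv B (φ z).re * (φ z).im) * (deriv φ z).re +
      B (φ z).re * (deriv φ z).im)]
  calc ∫⁻ x in Ioo α β, ENNReal.ofReal ((c₁ - c₀) ^ 2 / (b x - a x))
      ≤ ∫⁻ x in Ioo α β, ∫⁻ y, U.indicator (fun z => ENNReal.ofReal (D z ^ 2)) ⟨x, y⟩ := by
        refine setLIntegral_mono_ae' measurableSet_Ioo (ae_of_all _ fun x hx => ?_)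
        have hmem : ∀ y : ℝ, (⟨x, y⟩ : ℂ) ∈ U ↔ y ∈ Ioo (a x) (b x) := fun y => by
          rw [hUdef]; exact ⟨fun h => h.2, fun h => ⟨hx, h⟩⟩
        have hind : (fun y : ℝ => U.indicator (fun z => ENNReal.ofReal (D z ^ 2)) ⟨x, y⟩) =
            (Ioo (a x) (b x)).indicator fun y : ℝ => ENNReal.ofReal (D ⟨x, y⟩ ^ 2) := by
          ext y
          simp only [indicator, hmem]
        rw [hind, lintegral_indicator measurableSet_Ioo]
        have hline : ∀ y : ℝ, HasDerivAt (fun y : ℝ => (⟨x, y⟩ : ℂ)) Complex.I y := fun y => by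
          have := ((Complex.ofRealCLM.hasDerivAt (x := y)).mul_const Complex.I).const_add (x : ℂ)
          simp only [Complex.ofRealCLM_apply, Complex.ofReal_one, one_mul] at this
          rwa [show (fun y : ℝ => (⟨x, y⟩ : ℂ)) = fun y : ℝ => (x : ℂ) + (y : ℂ) * Complex.I from
            funext (Complex.mk_eq_add_mul_I x)]
        refine ofReal_sq_div_le_lintegral_sq (hab x hx) (fun y hy => ?_) ?_ (h₀ x hx) (h₁ x hx)
        · have hd := (hφ.differentiableAt (hU.mem_nhds ((hmem y).2 hy))).hasDerivAt
          exact hasDerivAt_sliceAffine_comp hAd hBd (hd.comp_of_eq y (hline y) rfl)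
        · refine hDc.comp (Continuous.continuousOn ?_) fun y hy => (hmem y).2 hy
          exact continuous_iff_continuousAt.2 fun y => (hline y).continuousAt
    _ ≤ ∫⁻ x, ∫⁻ y, U.indicator (fun z => ENNReal.ofReal (D z ^ 2)) ⟨x, y⟩ :=
        setLIntegral_le_lintegral _ _
    _ = ∫⁻ z in U, ENNReal.ofReal (D z ^ 2) := by
        rw [← lintegral_indicator hU.measurableSet, Complex.lintegral_eq_lintegral_re_im]
        rw [aemeasurable_indicator_iff hU.measurableSet]
        exact (ENNReal.continuous_ofReal.comp_continuousOn (hDc.pow 2)).aemeasurable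
          hU.measurableSet
    _ ≤ ∫⁻ z in U, ENNReal.ofReal (‖deriv φ z‖ ^ 2) *
          ENNReal.ofReal (sliceAffineEnergy A B (φ z)) := by
        refine lintegral_mono fun z => ?_
        rw [← ENNReal.ofReal_mul (sq_nonneg _)]
        exact ENNReal.ofReal_le_ofReal (hDle z)
    _ = ∫⁻ z in φ '' U, ENNReal.ofReal (sliceAffineEnergy A B z) :=
        (Complex.lintegral_image_eq hU hφ hinj
          fun z => ENNReal.ofReal (sliceAffineEnergy A B z)).symm
    _ ≤ _ := lintegral_mono_set hmaps.image_subset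

/-! ### Holomorphy of the inverse -/

/-- The inverse of an injective holomorphic function is holomorphic. Away from the isolated zeros of
the derivative this is the inverse function theorem, and at these zeros it follows from the
continuity of the inverse by the removable singularity theorem. -/
theorem differentiableOn_of_leftInvOn {f g : ℂ → ℂ} {U : Set ℂ} (hU : IsOpen U)
    (hf : DifferentiableOn ℂ f U) (hg : LeftInvOn g f U) :
    DifferentiableOn ℂ g (f '' U) := by
  have hinj : InjOn f U := hg.injOn
  have han : ∀ z ∈ U, AnalyticAt ℂ f z := fun z hz => hf.analyticAt (hU.mem_nhds hz)
  have hnc : ∀ z ∈ U, ¬ ∀ᶠ u in 𝓝 z, f u = f z := fun z hz h => by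
    have h1 : ∀ᶠ u in 𝓝[≠] z, f u = f z ∧ u ∈ U :=
      (h.and (hU.mem_nhds hz)).filter_mono nhdsWithin_le_nhds
    obtain ⟨u, ⟨hu, huU⟩, hne⟩ := (h1.and self_mem_nhdsWithin).exists
    exact hne (hinj huU hz hu)
  have hmap : ∀ z ∈ U, 𝓝 (f z) ≤ map f (𝓝 z) := fun z hz =>
    (han z hz).eventually_constant_or_nhds_le_map_nhds.resolve_left (hnc z hz)
  have hgc : ∀ z ∈ U, ContinuousAt g (f z) := fun z hz => by
    have h1 : map g (map f (𝓝 z)) = 𝓝 z := by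
      rw [Filter.map_map]
      have : g ∘ f =ᶠ[𝓝 z] id := by
        filter_upwards [hU.mem_nhds hz] with u hu using hg hu
      rw [Filter.map_congr this, Filter.map_id]
    rw [ContinuousAt, hg hz, Tendsto, ← h1]
    exact Filter.map_mono (hmap z hz)
  have hopen : IsOpen (f '' U) := isOpen_iff_mem_nhds.2 fun q ⟨z, hz, hzq⟩ => by
    rw [← hzq]
    exact hmap z hz (mem_map.2 (mem_of_superset (hU.mem_nhds hz) (subset_preimage_image f U)))
  have hdiff : ∀ z ∈ U, deriv f z ≠ 0 → DifferentiableAt ℂ g (f z) := fun z hz hne => by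
    refine (HasDerivAt.of_local_left_inverse (f := f) (hgc z hz) ?_ hne ?_).differentiableAt
    · rw [hg hz]; exact (han z hz).differentiableAt.hasDerivAt
    · filter_upwards [hopen.mem_nhds (mem_image_of_mem f hz)] with q hq
      obtain ⟨u, hu, rfl⟩ := hq
      rw [hg hu]
  rintro _ ⟨z, hz, rfl⟩
  refine AnalyticAt.differentiableWithinAt
    (Complex.analyticAt_of_differentiable_on_punctured_nhds_of_continuousAt ?_ (hgc z hz))
  have hiso : ∀ᶠ u in 𝓝[≠] z, deriv f u ≠ 0 := by
    refine (han z hz).deriv.eventually_eq_zero_or_eventually_ne_zero.resolve_left fun h0 => ?_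
    obtain ⟨r, hr, hball⟩ := Metric.eventually_nhds_iff_ball.1 (h0.and (hU.mem_nhds hz))
    refine hnc z hz (Metric.eventually_nhds_iff_ball.2 ⟨r, hr, fun u hu => ?_⟩)
    exact Metric.isOpen_ball.is_const_of_deriv_eq_zero (convex_ball z r).isPreconnected
      (fun v hv => (han v (hball v hv).2).differentiableAt.differentiableWithinAt)
      (fun v hv => (hball v hv).1) hu (Metric.mem_ball_self hr)
  have hgz : Tendsto g (𝓝[≠] (f z)) (𝓝[≠] z) := by
    refine tendsto_nhdsWithin_iff.2 ⟨?_, ?_⟩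
    · have := (hgc z hz).tendsto.mono_left (nhdsWithin_le_nhds (s := {f z}ᶜ))
      rwa [hg hz] at this
    · filter_upwards [self_mem_nhdsWithin,
        nhdsWithin_le_nhds (hopen.mem_nhds (mem_image_of_mem f hz))] with q hq hqU
      obtain ⟨u, hu, rfl⟩ := hqU
      rw [hg hu]
      rintro rfl
      exact hq rfl
  filter_upwards [hgz.eventually hiso,
    nhdsWithin_le_nhds (hopen.mem_nhds (mem_image_of_mem f hz))] with q hq hqU
  obtain ⟨u, hu, rfl⟩ := hqU
  rw [hg hu] at hq
  exact hdiff u hu hq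

/-! ### Geometry of the quadrilateral -/

/-- Four lines `y = a i * t + b i`, consecutive ones meeting over `p i`, which bound a convex
quadrilateral (`turn`: the left turns at the vertices), positioned so that the vertices
`0, 1` lie to the left of the vertices `2, 3`. Then line `0` is above the quadrilateral and
line `2` is below it. -/
structure IsLeftRightQuadrilateral (a b p : Fin 4 → ℝ) : Prop where
  meet : ∀ i, a (i + 1) * p i + b (i + 1) = a i * p i + b i
  turn : ∀ i, 0 < (p (i + 1) - p i) * (p (i + 2) - p (i + 1)) * (a (i + 2) - a (i + 1))
  lt_zero_two : p 0 < p 2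
  lt_one_three : p 1 < p 3

/-- The vertical distance between the lines `0` and `2`. -/
def gap (a b : Fin 4 → ℝ) (t : ℝ) : ℝ := (a 0 - a 2) * t + (b 0 - b 2)

/-- The line `y = a t + b`, compressed by `ε` in the vertical direction. -/
def thinLine (a b : Fin 4 → ℝ) (ε : ℝ) (i : Fin 4) : Set ℂ :=
  {z | z.im = ε * (a i * z.re + b i)}

/-- The vertex over `p i`, compressed by `ε` in the vertical direction. -/
def thinVertex (a b p : Fin 4 → ℝ) (ε : ℝ) (i : Fin 4) : ℂ := ⟨p i, ε * (a i * p i + b i)⟩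

theorem continuous_gap (a b : Fin 4 → ℝ) : Continuous (gap a b) := by
  unfold gap; fun_prop

theorem nonneg_of_mem_convexHull {ι : Type*} {X : ι → ℂ} {c d e : ℝ}
    (h : ∀ i, 0 ≤ c * (X i).re + d * (X i).im + e) {z : ℂ} (hz : z ∈ convexHull ℝ (range X)) :
    0 ≤ c * z.re + d * z.im + e := by
  have hconv : Convex ℝ {z : ℂ | 0 ≤ c * z.re + d * z.im + e} := by
    intro u hu v hv s t hs ht hst
    simp only [mem_ofPred_eq, Complex.add_re, Complex.add_im, Complex.real_smul, Complex.re_ofReal_mul,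
      Complex.im_ofReal_mul] at *
    have h1 := mul_nonneg hs hu
    have h2 := mul_nonneg ht hv
    have h3 : e = s * e + t * e := by rw [← add_mul, hst, one_mul]
    nlinarith
  exact convexHull_min (s := range X) (range_subset_iff.2 h) hconv hz

theorem mk_mem_of_convex_of_mem_line {S : Set ℂ} (hS : Convex ℝ S) {c d u v x : ℝ}
    (hu : (⟨u, c * u + d⟩ : ℂ) ∈ S) (hv : (⟨v, c * v + d⟩ : ℂ) ∈ S) (hux : u ≤ x) (hxv : x ≤ v) :
    (⟨x, c * x + d⟩ : ℂ) ∈ S := by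
  have hx : x ∈ segment ℝ u v := by rw [segment_eq_Icc (hux.trans hxv)]; exact ⟨hux, hxv⟩
  obtain ⟨s, t, hs, ht, hst, rfl⟩ := hx
  convert hS hu hv hs ht hst using 1
  apply Complex.ext
  · simp
  · simp only [smul_eq_mul, Complex.add_im, Complex.real_smul, Complex.im_ofReal_mul]
    linear_combination (-d) * hst

theorem mk_mem_of_convex_of_mem_vertical {S : Set ℂ} (hS : Convex ℝ S) {x u v y : ℝ}
    (hu : (⟨x, u⟩ : ℂ) ∈ S) (hv : (⟨x, v⟩ : ℂ) ∈ S) (huy : u ≤ y) (hyv : y ≤ v) :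
    (⟨x, y⟩ : ℂ) ∈ S := by
  have hx : y ∈ segment ℝ u v := by rw [segment_eq_Icc (huy.trans hyv)]; exact ⟨huy, hyv⟩
  obtain ⟨s, t, hs, ht, hst, rfl⟩ := hx
  convert hS hu hv hs ht hst using 1
  apply Complex.ext
  · simp only [Complex.add_re, Complex.real_smul, Complex.re_ofReal_mul]
    linear_combination (-x) * hst
  · simp

namespace IsLeftRightQuadrilateral

variable {a b p : Fin 4 → ℝ} (h : IsLeftRightQuadrilateral a b p)
include h

theorem meet_zero : a 1 * p 0 + b 1 = a 0 * p 0 + b 0 := h.meet 0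
theorem meet_one : a 2 * p 1 + b 2 = a 1 * p 1 + b 1 := h.meet 1
theorem meet_two : a 3 * p 2 + b 3 = a 2 * p 2 + b 2 := h.meet 2
theorem meet_three : a 0 * p 3 + b 0 = a 3 * p 3 + b 3 := h.meet 3

theorem turn_zero : 0 < (p 1 - p 0) * (p 2 - p 1) * (a 2 - a 1) := h.turn 0
theorem turn_one : 0 < (p 2 - p 1) * (p 3 - p 2) * (a 3 - a 2) := h.turn 1
theorem turn_two : 0 < (p 3 - p 2) * (p 0 - p 3) * (a 0 - a 3) := h.turn 2
theorem turn_three : 0 < (p 0 - p 3) * (p 1 - p 0) * (a 1 - a 0) := h.turn 3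

/-- If the vertices did not split like this, all four of them would be local extrema of the first
coordinate, and then all four slope increments `a (i + 1) - a i` would be negative. -/
theorem lt_one_two_and_lt_zero_three : p 1 < p 2 ∧ p 0 < p 3 := by
  have t0 := h.turn_zero
  have t1 := h.turn_one
  have t2 := h.turn_two
  have t3 := h.turn_three
  have h02 := h.lt_zero_two
  have h13 := h.lt_one_three
  have key : ∀ {u v w : ℝ}, 0 < u * v * w → u * v < 0 → w < 0 := fun huvw huv => by
    by_contra hw
    nlinarith
  constructor
  · by_contra hc
    rcases (not_lt.1 hc).lt_or_eq with hlt | heq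
    · have c0 := key t0 (by nlinarith)
      have c1 := key t1 (by nlinarith)
      have c2 := key t2 (by nlinarith)
      have c3 := key t3 (by nlinarith)
      linarith
    · rw [heq] at t0; simp at t0
  · by_contra hc
    rcases (not_lt.1 hc).lt_or_eq with hlt | heq
    · have c0 := key t0 (by nlinarith)
      have c1 := key t1 (by nlinarith)
      have c2 := key t2 (by nlinarith)
      have c3 := key t3 (by nlinarith)
      linarith
    · rw [heq] at t3; simp at t3

theorem lt_one_two : p 1 < p 2 := h.lt_one_two_and_lt_zero_three.1
theorem lt_zero_three : p 0 < p 3 := h.lt_one_two_and_lt_zero_three.2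

theorem left_cases :
    (p 0 < p 1 ∧ a 1 < a 0 ∧ a 1 < a 2) ∨ (p 1 < p 0 ∧ a 0 < a 1 ∧ a 2 < a 1) := by
  have t0 := h.turn_zero
  have t3 := h.turn_three
  have h12 := sub_pos.2 h.lt_one_two
  have h03 := sub_pos.2 h.lt_zero_three
  rcases lt_trichotomy (p 0) (p 1) with hlt | heq | hlt
  · refine .inl ⟨hlt, ?_, ?_⟩
    · by_contra hc
      have : 0 ≤ (p 3 - p 0) * (p 1 - p 0) * (a 1 - a 0) :=
        mul_nonneg (mul_nonneg h03.le (by linarith)) (by linarith)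
      nlinarith
    · by_contra hc
      have : 0 ≤ (p 1 - p 0) * (p 2 - p 1) * (a 1 - a 2) :=
        mul_nonneg (mul_nonneg (by linarith) h12.le) (by linarith)
      nlinarith
  · rw [heq] at t0; simp at t0
  · refine .inr ⟨hlt, ?_, ?_⟩
    · by_contra hc
      have : 0 ≤ (p 3 - p 0) * (p 0 - p 1) * (a 0 - a 1) :=
        mul_nonneg (mul_nonneg h03.le (by linarith)) (by linarith)
      nlinarith
    · by_contra hc
      have : 0 ≤ (p 0 - p 1) * (p 2 - p 1) * (a 2 - a 1) :=
        mul_nonneg (mul_nonneg (by linarith) h12.le) (by linarith)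
      nlinarith

theorem right_cases :
    (p 2 < p 3 ∧ a 2 < a 3 ∧ a 0 < a 3) ∨ (p 3 < p 2 ∧ a 3 < a 2 ∧ a 3 < a 0) := by
  have t1 := h.turn_one
  have t2 := h.turn_two
  have h12 := sub_pos.2 h.lt_one_two
  have h03 := sub_pos.2 h.lt_zero_three
  rcases lt_trichotomy (p 2) (p 3) with hlt | heq | hlt
  · refine .inl ⟨hlt, ?_, ?_⟩
    · by_contra hc
      have : 0 ≤ (p 2 - p 1) * (p 3 - p 2) * (a 2 - a 3) :=
        mul_nonneg (mul_nonneg h12.le (by linarith)) (by linarith)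
      nlinarith
    · by_contra hc
      have : 0 ≤ (p 3 - p 2) * (p 3 - p 0) * (a 0 - a 3) :=
        mul_nonneg (mul_nonneg (by linarith) h03.le) (by linarith)
      nlinarith
  · rw [heq] at t1; simp at t1
  · refine .inr ⟨hlt, ?_, ?_⟩
    · by_contra hc
      have : 0 ≤ (p 2 - p 1) * (p 2 - p 3) * (a 3 - a 2) :=
        mul_nonneg (mul_nonneg h12.le (by linarith)) (by linarith)
      nlinarith
    · by_contra hc
      have : 0 ≤ (p 2 - p 3) * (p 3 - p 0) * (a 3 - a 0) :=
        mul_nonneg (mul_nonneg (by linarith) h03.le) (by linarith)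
      nlinarith

theorem max_lt_min : max (p 0) (p 1) < min (p 2) (p 3) :=
  max_lt (lt_min h.lt_zero_two h.lt_zero_three) (lt_min h.lt_one_two h.lt_one_three)

theorem gap_pos (i : Fin 4) : 0 < gap a b (p i) := by
  have m0 := h.meet_zero
  have m1 := h.meet_one
  have m2 := h.meet_two
  have m3 := h.meet_three
  have hl := h.left_cases
  have hr := h.right_cases
  unfold gap
  fin_cases i <;> simp only [Fin.zero_eta, Fin.mk_one, Fin.reduceFinMk]
  · rcases hl with ⟨h1, h2, h3⟩ | ⟨h1, h2, h3⟩ <;> nlinarith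
  · rcases hl with ⟨h1, h2, h3⟩ | ⟨h1, h2, h3⟩ <;> nlinarith
  · rcases hr with ⟨h1, h2, h3⟩ | ⟨h1, h2, h3⟩ <;> nlinarith
  · rcases hr with ⟨h1, h2, h3⟩ | ⟨h1, h2, h3⟩ <;> nlinarith

theorem gap_max_pos : 0 < gap a b (max (p 0) (p 1)) := by
  rcases max_choice (p 0) (p 1) with e | e <;> rw [e] <;> exact h.gap_pos _

theorem gap_min_pos : 0 < gap a b (min (p 2) (p 3)) := by
  rcases min_choice (p 2) (p 3) with e | e <;> rw [e] <;> exact h.gap_pos _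

theorem gap_pos_of_mem_Icc {x : ℝ} (hx : x ∈ Icc (max (p 0) (p 1)) (min (p 2) (p 3))) :
    0 < gap a b x := by
  have h1 := h.gap_max_pos
  have h2 := h.gap_min_pos
  unfold gap at *
  obtain ⟨hx1, hx2⟩ := hx
  rcases le_total 0 (a 0 - a 2) with hs | hs <;> nlinarith

theorem mem_convexHull_of_middle (ε : ℝ) {z : ℂ} (hz : z.re ∈ Icc (max (p 0) (p 1)) (min (p 2) (p 3)))
    (hz₂ : ε * (a 2 * z.re + b 2) ≤ z.im) (hz₀ : z.im ≤ ε * (a 0 * z.re + b 0)) :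
    z ∈ convexHull ℝ (range (thinVertex a b p ε)) := by
  have hV : ∀ i, thinVertex a b p ε i ∈ convexHull ℝ (range (thinVertex a b p ε)) := fun i =>
    subset_convexHull ℝ _ (mem_range_self i)
  have hc := convex_convexHull ℝ (range (thinVertex a b p ε))
  obtain ⟨hx1, hx2⟩ := hz
  have e0 : thinVertex a b p ε 0 = ⟨p 0, (ε * a 0) * p 0 + ε * b 0⟩ := by
    rw [thinVertex]; congr 1; ring
  have e1 : thinVertex a b p ε 1 = ⟨p 1, (ε * a 2) * p 1 + ε * b 2⟩ := by
    rw [thinVertex]; congr 1; linear_combination -ε * h.meet_one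
  have e2 : thinVertex a b p ε 2 = ⟨p 2, (ε * a 2) * p 2 + ε * b 2⟩ := by
    rw [thinVertex]; congr 1; ring
  have e3 : thinVertex a b p ε 3 = ⟨p 3, (ε * a 0) * p 3 + ε * b 0⟩ := by
    rw [thinVertex]; congr 1; linear_combination -ε * h.meet_three
  refine mk_mem_of_convex_of_mem_vertical (x := z.re) (y := z.im) hc
    (mk_mem_of_convex_of_mem_line hc (e1 ▸ hV 1) (e2 ▸ hV 2) ((le_max_right _ _).trans hx1)
      (hx2.trans (min_le_left _ _)))
    (mk_mem_of_convex_of_mem_line hc (e0 ▸ hV 0) (e3 ▸ hV 3) ((le_max_left _ _).trans hx1)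
      (hx2.trans (min_le_right _ _))) ?_ ?_
  · linarith
  · linarith

theorem mem_interior_of_middle (ε : ℝ) {z : ℂ} (hz : z.re ∈ Ioo (max (p 0) (p 1)) (min (p 2) (p 3)))
    (hz₂ : ε * (a 2 * z.re + b 2) < z.im) (hz₀ : z.im < ε * (a 0 * z.re + b 0)) :
    z ∈ interior (convexHull ℝ (range (thinVertex a b p ε))) := by
  have hopen : IsOpen (({z : ℂ | max (p 0) (p 1) < z.re} ∩ {z | z.re < min (p 2) (p 3)}) ∩
      ({z | ε * (a 2 * z.re + b 2) < z.im} ∩ {z | z.im < ε * (a 0 * z.re + b 0)})) := by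
    refine ((isOpen_lt ?_ ?_).inter (isOpen_lt ?_ ?_)).inter
      ((isOpen_lt ?_ ?_).inter (isOpen_lt ?_ ?_)) <;> fun_prop
  refine mem_interior.2 ⟨_, ?_, hopen, ⟨⟨hz.1, hz.2⟩, hz₂, hz₀⟩⟩
  rintro v ⟨⟨h1, h2⟩, h3, h4⟩
  exact h.mem_convexHull_of_middle ε ⟨le_of_lt h1, le_of_lt h2⟩ (le_of_lt h3) (le_of_lt h4)

section Thin

variable {ε : ℝ} (hε : 0 < ε)
include hε

theorem thin_bounds {z : ℂ} (hz : z ∈ convexHull ℝ (range (thinVertex a b p ε))) :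
    (ε * (a 2 * z.re + b 2) ≤ z.im ∧ z.im ≤ ε * (a 0 * z.re + b 0)) ∧
    (0 ≤ (p 1 - p 0) * (z.im - ε * (a 1 * z.re + b 1)) ∧
      0 ≤ (p 3 - p 2) * (z.im - ε * (a 3 * z.re + b 3))) ∧
    min (p 0) (p 1) ≤ z.re ∧ z.re ≤ max (p 2) (p 3) := by
  have m0 := h.meet_zero
  have m1 := h.meet_one
  have m2 := h.meet_two
  have m3 := h.meet_three
  have g0 := h.gap_pos 0
  have g1 := h.gap_pos 1
  have g2 := h.gap_pos 2
  have g3 := h.gap_pos 3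
  have h12 := sub_pos.2 h.lt_one_two
  have h03 := sub_pos.2 h.lt_zero_three
  have h13 := sub_pos.2 h.lt_one_three
  have h02 := sub_pos.2 h.lt_zero_two
  unfold gap at g0 g1 g2 g3
  refine ⟨⟨?_, ?_⟩, ⟨?_, ?_⟩, ?_, ?_⟩
  · have := nonneg_of_mem_convexHull (c := -(ε * a 2)) (d := 1) (e := -(ε * b 2)) (fun i => ?_) hz
    · linarith
    · have : 0 ≤ ε * (a i * p i + b i - (a 2 * p i + b 2)) := by
        refine mul_nonneg hε.le ?_
        fin_cases i <;> simp only [Fin.zero_eta, Fin.mk_one, Fin.reduceFinMk] <;> linarith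
      simp only [thinVertex]
      linarith
  · have := nonneg_of_mem_convexHull (c := ε * a 0) (d := -1) (e := ε * b 0) (fun i => ?_) hz
    · linarith
    · have : 0 ≤ ε * (a 0 * p i + b 0 - (a i * p i + b i)) := by
        refine mul_nonneg hε.le ?_
        fin_cases i <;> simp only [Fin.zero_eta, Fin.mk_one, Fin.reduceFinMk] <;> linarith
      simp only [thinVertex]
      linarith
  · have := nonneg_of_mem_convexHull (c := -((p 1 - p 0) * (ε * a 1))) (d := p 1 - p 0)
      (e := -((p 1 - p 0) * (ε * b 1))) (fun i => ?_) hz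
    · linarith
    · have : 0 ≤ ε * ((p 1 - p 0) * (a i * p i + b i - (a 1 * p i + b 1))) := by
        refine mul_nonneg hε.le ?_
        fin_cases i <;> simp only [Fin.zero_eta, Fin.mk_one, Fin.reduceFinMk]
        · rw [m0, sub_self, mul_zero]
        · rw [sub_self, mul_zero]
        · have e : a 2 * p 2 + b 2 - (a 1 * p 2 + b 1) = (a 2 - a 1) * (p 2 - p 1) := by
            linear_combination m1
          rw [e]; rcases h.left_cases with ⟨c1, c2, c3⟩ | ⟨c1, c2, c3⟩
          · exact mul_nonneg (by linarith) (mul_nonneg (by linarith) h12.le)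
          · exact mul_nonneg_of_nonpos_of_nonpos (by linarith)
              (mul_nonpos_of_nonpos_of_nonneg (by linarith) h12.le)
        · have e : a 3 * p 3 + b 3 - (a 1 * p 3 + b 1) = (a 0 - a 1) * (p 3 - p 0) := by
            linear_combination -m3 - m0
          rw [e]; rcases h.left_cases with ⟨c1, c2, c3⟩ | ⟨c1, c2, c3⟩
          · exact mul_nonneg (by linarith) (mul_nonneg (by linarith) h03.le)
          · exact mul_nonneg_of_nonpos_of_nonpos (by linarith)
              (mul_nonpos_of_nonpos_of_nonneg (by linarith) h03.le)
      simp only [thinVertex]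
      linarith
  · have := nonneg_of_mem_convexHull (c := -((p 3 - p 2) * (ε * a 3))) (d := p 3 - p 2)
      (e := -((p 3 - p 2) * (ε * b 3))) (fun i => ?_) hz
    · linarith
    · have : 0 ≤ ε * ((p 3 - p 2) * (a i * p i + b i - (a 3 * p i + b 3))) := by
        refine mul_nonneg hε.le ?_
        fin_cases i <;> simp only [Fin.zero_eta, Fin.mk_one, Fin.reduceFinMk]
        · have e : a 0 * p 0 + b 0 - (a 3 * p 0 + b 3) = (a 3 - a 0) * (p 3 - p 0) := by
            linear_combination m3
          rw [e]; rcases h.right_cases with ⟨c1, c2, c3⟩ | ⟨c1, c2, c3⟩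
          · exact mul_nonneg (by linarith) (mul_nonneg (by linarith) h03.le)
          · exact mul_nonneg_of_nonpos_of_nonpos (by linarith)
              (mul_nonpos_of_nonpos_of_nonneg (by linarith) h03.le)
        · have e : a 1 * p 1 + b 1 - (a 3 * p 1 + b 3) = (a 3 - a 2) * (p 2 - p 1) := by
            linear_combination -m1 - m2
          rw [e]; rcases h.right_cases with ⟨c1, c2, c3⟩ | ⟨c1, c2, c3⟩
          · exact mul_nonneg (by linarith) (mul_nonneg (by linarith) h12.le)
          · exact mul_nonneg_of_nonpos_of_nonpos (by linarith)
              (mul_nonpos_of_nonpos_of_nonneg (by linarith) h12.le)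
        · rw [m2, sub_self, mul_zero]
        · rw [sub_self, mul_zero]
      simp only [thinVertex]
      linarith
  · have := nonneg_of_mem_convexHull (c := 1) (d := 0) (e := -min (p 0) (p 1)) (fun i => ?_) hz
    · linarith
    · have h0 := min_le_left (p 0) (p 1)
      have h1 := min_le_right (p 0) (p 1)
      simp only [thinVertex]
      fin_cases i <;> simp only [Fin.zero_eta, Fin.mk_one, Fin.reduceFinMk] <;> linarith
  · have := nonneg_of_mem_convexHull (c := -1) (d := 0) (e := max (p 2) (p 3)) (fun i => ?_) hz
    · linarith
    · have h0 := le_max_left (p 2) (p 3)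
      have h1 := le_max_right (p 2) (p 3)
      simp only [thinVertex]
      fin_cases i <;> simp only [Fin.zero_eta, Fin.mk_one, Fin.reduceFinMk] <;> linarith

theorem thinLine_zero_notMem_interior {z : ℂ} (hz : z ∈ thinLine a b ε 0) :
    z ∉ interior (convexHull ℝ (range (thinVertex a b p ε))) := fun hi => by
  have hc : ContinuousAt (fun t : ℝ => z + (t : ℂ) * Complex.I) 0 := by fun_prop
  have h1 : ∀ᶠ t : ℝ in 𝓝[>] 0, z + (t : ℂ) * Complex.I ∈ convexHull ℝ (range (thinVertex a b p ε)) :=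
    (hc.eventually_mem (by simpa using mem_interior_iff_mem_nhds.1 hi)).filter_mono
      nhdsWithin_le_nhds
  obtain ⟨t, ht, ht0⟩ := (h1.and self_mem_nhdsWithin).exists
  have := (h.thin_bounds hε ht).1.2
  simp only [Complex.add_im, Complex.mul_im, Complex.ofReal_re, Complex.I_im, Complex.ofReal_im,
    Complex.I_re, Complex.add_re, Complex.mul_re, mul_zero, mul_one, sub_self, add_zero] at this
  have hz' : z.im = ε * (a 0 * z.re + b 0) := hz
  have : 0 < t := ht0
  linarith

theorem thinLine_two_notMem_interior {z : ℂ} (hz : z ∈ thinLine a b ε 2) :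
    z ∉ interior (convexHull ℝ (range (thinVertex a b p ε))) := fun hi => by
  have hc : ContinuousAt (fun t : ℝ => z + (t : ℂ) * Complex.I) 0 := by fun_prop
  have h1 : ∀ᶠ t : ℝ in 𝓝[<] 0, z + (t : ℂ) * Complex.I ∈ convexHull ℝ (range (thinVertex a b p ε)) :=
    (hc.eventually_mem (by simpa using mem_interior_iff_mem_nhds.1 hi)).filter_mono
      nhdsWithin_le_nhds
  obtain ⟨t, ht, ht0⟩ := (h1.and self_mem_nhdsWithin).exists
  have := (h.thin_bounds hε ht).1.1
  simp only [Complex.add_im, Complex.mul_im, Complex.ofReal_re, Complex.I_im, Complex.ofReal_im,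
    Complex.I_re, Complex.add_re, Complex.mul_re, mul_zero, mul_one, sub_self, add_zero] at this
  have hz' : z.im = ε * (a 2 * z.re + b 2) := hz
  have : t < 0 := ht0
  linarith

/-- In the quadrilateral, the side on line `2` starts at the vertex `1`; so if the vertex `1` is to
the right of the vertex `0`, that side stays in the middle region on the left. -/
theorem max_le_re_of_mem_line_two (h01 : p 0 < p 1) {z : ℂ} (hz : z ∈ thinLine a b ε 2)
    (hzQ : z ∈ convexHull ℝ (range (thinVertex a b p ε))) : max (p 0) (p 1) ≤ z.re := by
  have hb := (h.thin_bounds hε hzQ).2.1.1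
  rw [max_eq_right h01.le]
  have hz' : z.im = ε * (a 2 * z.re + b 2) := hz
  rcases h.left_cases with ⟨c1, c2, c3⟩ | ⟨c1, c2, c3⟩
  · have e : z.im - ε * (a 1 * z.re + b 1) = (ε * (a 2 - a 1)) * (z.re - p 1) := by
      rw [hz']; linear_combination ε * h.meet_one
    rw [e, mul_nonneg_iff_of_pos_left (by linarith),
      mul_nonneg_iff_of_pos_left (mul_pos hε (by linarith))] at hb
    linarith
  · linarith

theorem max_le_re_of_mem_line_zero (h10 : p 1 < p 0) {z : ℂ} (hz : z ∈ thinLine a b ε 0)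
    (hzQ : z ∈ convexHull ℝ (range (thinVertex a b p ε))) : max (p 0) (p 1) ≤ z.re := by
  have hb := (h.thin_bounds hε hzQ).2.1.1
  rw [max_eq_left h10.le]
  have hz' : z.im = ε * (a 0 * z.re + b 0) := hz
  rcases h.left_cases with ⟨c1, c2, c3⟩ | ⟨c1, c2, c3⟩
  · linarith
  · have e : (p 1 - p 0) * (z.im - ε * (a 1 * z.re + b 1)) =
        (p 0 - p 1) * ((ε * (a 1 - a 0)) * (z.re - p 0)) := by
      rw [hz']; linear_combination (p 0 - p 1) * ε * h.meet_zero
    rw [e, mul_nonneg_iff_of_pos_left (by linarith),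
      mul_nonneg_iff_of_pos_left (mul_pos hε (by linarith))] at hb
    linarith

theorem re_le_min_of_mem_line_two (h23 : p 2 < p 3) {z : ℂ} (hz : z ∈ thinLine a b ε 2)
    (hzQ : z ∈ convexHull ℝ (range (thinVertex a b p ε))) : z.re ≤ min (p 2) (p 3) := by
  have hb := (h.thin_bounds hε hzQ).2.1.2
  rw [min_eq_left h23.le]
  have hz' : z.im = ε * (a 2 * z.re + b 2) := hz
  rcases h.right_cases with ⟨c1, c2, c3⟩ | ⟨c1, c2, c3⟩
  · have e : z.im - ε * (a 3 * z.re + b 3) = (ε * (a 3 - a 2)) * (p 2 - z.re) := by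
      rw [hz']; linear_combination -ε * h.meet_two
    rw [e, mul_nonneg_iff_of_pos_left (by linarith),
      mul_nonneg_iff_of_pos_left (mul_pos hε (by linarith))] at hb
    linarith
  · linarith

theorem re_le_min_of_mem_line_zero (h32 : p 3 < p 2) {z : ℂ} (hz : z ∈ thinLine a b ε 0)
    (hzQ : z ∈ convexHull ℝ (range (thinVertex a b p ε))) : z.re ≤ min (p 2) (p 3) := by
  have hb := (h.thin_bounds hε hzQ).2.1.2
  rw [min_eq_right h32.le]
  have hz' : z.im = ε * (a 0 * z.re + b 0) := hz
  rcases h.right_cases with ⟨c1, c2, c3⟩ | ⟨c1, c2, c3⟩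
  · linarith
  · have e : (p 3 - p 2) * (z.im - ε * (a 3 * z.re + b 3)) =
        (p 2 - p 3) * ((ε * (a 0 - a 3)) * (p 3 - z.re)) := by
      rw [hz']; linear_combination -(p 2 - p 3) * ε * h.meet_three
    rw [e, mul_nonneg_iff_of_pos_left (by linarith),
      mul_nonneg_iff_of_pos_left (mul_pos hε (by linarith))] at hb
    linarith

end Thin

end IsLeftRightQuadrilateral

/-! ### Cut-off functions and the energy in the strip -/

/-- An upper bound for an integral over a planar region by slicing it vertically. -/
theorem Complex.setLIntegral_le_of_slices {Ω : Set ℂ} (hΩ : MeasurableSet Ω) {X : Set ℝ}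
    (hX : MeasurableSet X) {lo hi : ℝ → ℝ} (hlo : Continuous lo) (hhi : Continuous hi)
    (hsub : ∀ z ∈ Ω, z.re ∈ X ∧ z.im ∈ Icc (lo z.re) (hi z.re)) {F : ℂ → ENNReal}
    {e : ℝ → ENNReal} (he : Measurable e) (hFe : ∀ z ∈ Ω, F z ≤ e z.re) :
    ∫⁻ z in Ω, F z ≤ ∫⁻ x in X, e x * ENNReal.ofReal (hi x - lo x) := by
  set R : Set ℂ := {z | z.re ∈ X ∧ z.im ∈ Icc (lo z.re) (hi z.re)} with hRdef
  have hR : MeasurableSet R := by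
    refine (Complex.measurable_re hX).inter (MeasurableSet.inter ?_ ?_)
    · exact measurableSet_le (hlo.measurable.comp Complex.measurable_re) Complex.measurable_im
    · exact measurableSet_le Complex.measurable_im (hhi.measurable.comp Complex.measurable_re)
  calc ∫⁻ z in Ω, F z ≤ ∫⁻ z in Ω, e z.re := setLIntegral_mono' hΩ hFe
    _ ≤ ∫⁻ z in R, e z.re := lintegral_mono_set hsub
    _ = ∫⁻ z, R.indicator (fun z => e z.re) z := (lintegral_indicator hR _).symm
    _ = ∫⁻ x : ℝ, ∫⁻ y : ℝ, R.indicator (fun z => e z.re) ⟨x, y⟩ :=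
        Complex.lintegral_eq_lintegral_re_im
          ((he.comp Complex.measurable_re).indicator hR).aemeasurable
    _ = ∫⁻ x : ℝ, X.indicator (fun x => e x * ENNReal.ofReal (hi x - lo x)) x := by
        refine lintegral_congr fun x => ?_
        by_cases hx : x ∈ X
        · have : (fun y : ℝ => R.indicator (fun z => e z.re) ⟨x, y⟩) =
              (Icc (lo x) (hi x)).indicator fun _ => e x := by
            ext y
            by_cases hy : y ∈ Icc (lo x) (hi x)
            · rw [indicator_of_mem hy, indicator_of_mem (show (⟨x, y⟩ : ℂ) ∈ R from ⟨hx, hy⟩)]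
            · rw [indicator_of_notMem hy, indicator_of_notMem fun h => hy h.2]
          rw [this, lintegral_indicator measurableSet_Icc, setLIntegral_const, Real.volume_Icc,
            indicator_of_mem hx]
        · have : (fun y : ℝ => R.indicator (fun z => e z.re) ⟨x, y⟩) = fun _ => 0 := by
            ext y
            rw [indicator_of_notMem fun h => hx h.1]
          rw [this, lintegral_zero, indicator_of_notMem hx]
    _ = _ := lintegral_indicator hX _

/-- A `C¹` step at the left end of a plateau: `0` up to `u - δ` and `1` from `u` on. -/
noncomputable def stepUp (δ u x : ℝ) : ℝ := Real.smoothTransition ((x - (u - δ)) / δ)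

/-- A `C¹` step at the right end of a plateau: `1` up to `v` and `0` from `v + δ` on. -/
noncomputable def stepDown (δ v x : ℝ) : ℝ := Real.smoothTransition ((v + δ - x) / δ)

/-- A smooth cut-off function, equal to `1` on `[u, v]` and to `0` outside `(u - δ, v + δ)`. -/
noncomputable def plateau (δ u v x : ℝ) : ℝ := stepUp δ u x + stepDown δ v x - 1

theorem contDiff_stepUp (δ u : ℝ) : ContDiff ℝ 1 (stepUp δ u) := by
  unfold stepUp
  exact Real.smoothTransition.contDiff.comp (by fun_prop)

theorem contDiff_stepDown (δ v : ℝ) : ContDiff ℝ 1 (stepDown δ v) := by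
  unfold stepDown
  exact Real.smoothTransition.contDiff.comp (by fun_prop)

theorem contDiff_plateau (δ u v : ℝ) : ContDiff ℝ 1 (plateau δ u v) :=
  ((contDiff_stepUp δ u).add (contDiff_stepDown δ v)).sub contDiff_const

section Plateau

variable {δ u v x : ℝ} (hδ : 0 < δ)
include hδ

theorem stepUp_eq_one (hx : u ≤ x) : stepUp δ u x = 1 :=
  Real.smoothTransition.one_of_one_le ((one_le_div hδ).2 (by linarith))

theorem stepUp_eq_zero (hx : x ≤ u - δ) : stepUp δ u x = 0 :=
  Real.smoothTransition.zero_of_nonpos (div_nonpos_of_nonpos_of_nonneg (by linarith) hδ.le)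

theorem stepDown_eq_one (hx : x ≤ v) : stepDown δ v x = 1 :=
  Real.smoothTransition.one_of_one_le ((one_le_div hδ).2 (by linarith))

theorem stepDown_eq_zero (hx : v + δ ≤ x) : stepDown δ v x = 0 :=
  Real.smoothTransition.zero_of_nonpos (div_nonpos_of_nonpos_of_nonneg (by linarith) hδ.le)

theorem plateau_eq_one (hx : x ∈ Icc u v) : plateau δ u v x = 1 := by
  rw [plateau, stepUp_eq_one hδ hx.1, stepDown_eq_one hδ hx.2]; norm_num

theorem plateau_eq_zero (huv : u ≤ v) (hx : x ≤ u - δ ∨ v + δ ≤ x) : plateau δ u v x = 0 := by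
  rcases hx with hx | hx
  · rw [plateau, stepUp_eq_zero hδ hx, stepDown_eq_one hδ (by linarith)]; norm_num
  · rw [plateau, stepDown_eq_zero hδ hx, stepUp_eq_one hδ (by linarith)]; norm_num

theorem plateau_nonneg (huv : u ≤ v) : 0 ≤ plateau δ u v x := by
  rcases le_total u x with hx | hx
  · rw [plateau, stepUp_eq_one hδ hx]
    have : 0 ≤ stepDown δ v x := Real.smoothTransition.nonneg _
    linarith
  · rw [plateau, stepDown_eq_one hδ (hx.trans huv)]
    have : 0 ≤ stepUp δ u x := Real.smoothTransition.nonneg _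
    linarith

end Plateau

theorem plateau_le_one {δ u v x : ℝ} : plateau δ u v x ≤ 1 := by
  have h1 : stepUp δ u x ≤ 1 := Real.smoothTransition.le_one _
  have h2 : stepDown δ v x ≤ 1 := Real.smoothTransition.le_one _
  rw [plateau]; linarith

theorem exists_bound_deriv_smoothTransition : ∃ K, ∀ x, |deriv Real.smoothTransition x| ≤ K := by
  have hc : Continuous (deriv Real.smoothTransition) :=
    (Real.smoothTransition.contDiff (n := 1)).continuous_deriv le_rfl
  obtain ⟨K, hK⟩ := isCompact_Icc.exists_bound_of_continuousOn (hc.continuousOn (s := Icc 0 1))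
  refine ⟨max K 0, fun x => ?_⟩
  by_cases hx : x ∈ Icc (0 : ℝ) 1
  · exact (hK x hx).trans (le_max_left _ _)
  · have h0 : deriv Real.smoothTransition x = 0 := by
      rw [mem_Icc, not_and_or, not_le, not_le] at hx
      rcases hx with hx | hx
      · have : Real.smoothTransition =ᶠ[𝓝 x] fun _ => 0 := by
          filter_upwards [Iio_mem_nhds hx] with t ht using
            Real.smoothTransition.zero_of_nonpos (le_of_lt ht)
        rw [this.deriv_eq, deriv_const]
      · have : Real.smoothTransition =ᶠ[𝓝 x] fun _ => 1 := by
          filter_upwards [Ioi_mem_nhds hx] with t ht using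
            Real.smoothTransition.one_of_one_le (le_of_lt ht)
        rw [this.deriv_eq, deriv_const]
    rw [h0, abs_zero]; exact le_max_right _ _

theorem exists_bound_deriv_plateau : ∃ K, ∀ u v x, |deriv (plateau 1 u v) x| ≤ K := by
  obtain ⟨K, hK⟩ := exists_bound_deriv_smoothTransition
  have hd : Differentiable ℝ Real.smoothTransition :=
    (Real.smoothTransition.contDiff (n := 1)).differentiable one_ne_zero
  refine ⟨K + K, fun u v x => ?_⟩
  have h1 : HasDerivAt (fun x : ℝ => x - (u - 1)) 1 x := (hasDerivAt_id x).sub_const _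
  have h2 : HasDerivAt (fun x : ℝ => v + 1 - x) (-1) x := (hasDerivAt_id x).const_sub _
  have h := ((HasDerivAt.comp x (hd (x - (u - 1))).hasDerivAt h1).add
    (HasDerivAt.comp x (hd (v + 1 - x)).hasDerivAt h2)).sub_const 1
  have e : plateau 1 u v = fun x => (Real.smoothTransition ∘ fun x => x - (u - 1)) x +
      (Real.smoothTransition ∘ fun x => v + 1 - x) x - 1 := by
    funext t; simp [plateau, stepUp, stepDown]
  have hder : deriv (plateau 1 u v) x = deriv Real.smoothTransition (x - (u - 1)) * 1 +
      deriv Real.smoothTransition (v + 1 - x) * -1 := by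
    rw [e]; exact h.deriv
  rw [hder]
  refine (abs_add_le _ _).trans (add_le_add ?_ ?_)
  · rw [mul_one]; exact hK _
  · rw [mul_neg_one, abs_neg]; exact hK _

/-- The upper half plane is mapped by the logarithm onto this strip. -/
def strip : Set ℂ := {z | z.im ∈ Ioo 0 Real.pi}

theorem measurableSet_strip : MeasurableSet strip := Complex.measurable_im measurableSet_Ioo

/-- In the strip the harmonic measure of the top side, cut off outside of `[u, 0]`, has energy
`-π u` up to a bounded error. -/
theorem exists_strip_energy_le : ∃ C, ∀ u ≤ 0,
    ∫⁻ z in strip, ENNReal.ofReal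
      (sliceAffineEnergy (fun x => Real.pi * (1 - plateau 1 u 0 x)) (plateau 1 u 0) z) ≤
    ENNReal.ofReal (Real.pi * -u + C) := by
  obtain ⟨K, hK⟩ := exists_bound_deriv_plateau
  set c : ℝ := Real.pi ^ 2 * K ^ 2 with hc
  have hc0 : 0 ≤ c := by positivity
  refine ⟨Real.pi * (2 + 2 * c), fun u hu => ?_⟩
  set e : ℝ → ENNReal := fun x => (Icc (u - 1) 1).indicator (fun _ => 1) x +
    (Icc (u - 1) u).indicator (fun _ => ENNReal.ofReal c) x +
    (Icc 0 1).indicator (fun _ => ENNReal.ofReal c) x with he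
  have hem : ∀ (s : Set ℝ) (_ : MeasurableSet s) (k : ENNReal), Measurable (s.indicator fun _ => k) :=
    fun s hs k => measurable_const.indicator hs
  have hmeas : Measurable e :=
    ((hem _ measurableSet_Icc _).add (hem _ measurableSet_Icc _)).add (hem _ measurableSet_Icc _)
  refine (Complex.setLIntegral_le_of_slices measurableSet_strip MeasurableSet.univ
    (lo := fun _ => 0) (hi := fun _ => Real.pi) continuous_const continuous_const
    (fun z hz => ⟨mem_univ _, hz.1.le, hz.2.le⟩) hmeas (fun z hz => ?_)).trans ?_
  · have hdp : Differentiable ℝ (plateau 1 u 0) :=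
      (contDiff_plateau 1 u 0).differentiable one_ne_zero
    have hdA : deriv (fun x => Real.pi * (1 - plateau 1 u 0 x)) z.re =
        Real.pi * -deriv (plateau 1 u 0) z.re :=
      (((hdp z.re).hasDerivAt.const_sub 1).const_mul Real.pi).deriv
    have hE : sliceAffineEnergy (fun x => Real.pi * (1 - plateau 1 u 0 x)) (plateau 1 u 0) z =
        deriv (plateau 1 u 0) z.re ^ 2 * (Real.pi - z.im) ^ 2 + plateau 1 u 0 z.re ^ 2 := by
      rw [sliceAffineEnergy, hdA]; ring
    have hzero : (z.re < u - 1 ∨ 1 < z.re) → plateau 1 u 0 z.re = 0 := fun h =>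
      plateau_eq_zero one_pos hu (h.imp le_of_lt fun h => by linarith)
    have hder : (z.re ∉ Icc (u - 1) u ∧ z.re ∉ Icc (0 : ℝ) 1) →
        deriv (plateau 1 u 0) z.re = 0 := by
      rintro ⟨h1, h2⟩
      have hloc : ∃ k : ℝ, plateau 1 u 0 =ᶠ[𝓝 z.re] fun _ => k := by
        rcases lt_or_ge z.re (u - 1) with h | h
        · refine ⟨0, ?_⟩
          filter_upwards [Iio_mem_nhds h] with t ht using
            plateau_eq_zero one_pos hu (.inl (le_of_lt ht))
        rcases lt_or_ge 1 z.re with h' | h'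
        · refine ⟨0, ?_⟩
          filter_upwards [Ioi_mem_nhds h'] with t ht using
            plateau_eq_zero one_pos hu (.inr (by linarith [mem_Ioi.1 ht]))
        have hu' : u < z.re := not_le.1 fun h3 => h1 ⟨h, h3⟩
        have h0' : z.re < 0 := not_le.1 fun h3 => h2 ⟨h3, h'⟩
        refine ⟨1, ?_⟩
        filter_upwards [Ioo_mem_nhds hu' h0'] with t ht using
          plateau_eq_one one_pos ⟨ht.1.le, ht.2.le⟩
      obtain ⟨k, hk⟩ := hloc
      rw [hk.deriv_eq, deriv_const]
    have hp : ENNReal.ofReal (plateau 1 u 0 z.re ^ 2) ≤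
        (Icc (u - 1) 1).indicator (fun _ => 1) z.re := by
      by_cases h : z.re ∈ Icc (u - 1) 1
      · rw [indicator_of_mem h, ← ENNReal.ofReal_one]
        refine ENNReal.ofReal_le_ofReal ?_
        exact pow_le_one₀ (plateau_nonneg one_pos hu) plateau_le_one
      · rw [mem_Icc, not_and_or, not_le, not_le] at h
        rw [hzero h]; simp
    have hd : ENNReal.ofReal (deriv (plateau 1 u 0) z.re ^ 2 * (Real.pi - z.im) ^ 2) ≤
        (Icc (u - 1) u).indicator (fun _ => ENNReal.ofReal c) z.re +
        (Icc 0 1).indicator (fun _ => ENNReal.ofReal c) z.re := by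
      have hle : deriv (plateau 1 u 0) z.re ^ 2 * (Real.pi - z.im) ^ 2 ≤ c := by
        rw [hc, mul_comm]
        refine mul_le_mul ?_ ?_ (sq_nonneg _) (sq_nonneg _)
        · exact pow_le_pow_left₀ (by linarith [hz.2]) (by linarith [hz.1]) 2
        · exact sq_le_sq' (by linarith [(abs_le.1 (hK u 0 z.re)).1])
            (abs_le.1 (hK u 0 z.re)).2
      by_cases h1 : z.re ∈ Icc (u - 1) u
      · rw [indicator_of_mem h1]
        exact le_add_right (ENNReal.ofReal_le_ofReal hle)
      by_cases h2 : z.re ∈ Icc (0 : ℝ) 1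
      · rw [indicator_of_mem h2]
        exact le_add_left (ENNReal.ofReal_le_ofReal hle)
      rw [hder ⟨h1, h2⟩]; simp
    rw [hE, ENNReal.ofReal_add (by positivity) (by positivity), he, add_comm]
    simp only [add_assoc]
    exact add_le_add hp hd
  · rw [Measure.restrict_univ, lintegral_mul_const _ hmeas, he,
      lintegral_add_right _ (hem _ measurableSet_Icc _),
      lintegral_add_right _ (hem _ measurableSet_Icc _),
      lintegral_indicator measurableSet_Icc, lintegral_indicator measurableSet_Icc,
      lintegral_indicator measurableSet_Icc, setLIntegral_const, setLIntegral_const,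
      setLIntegral_const, Real.volume_Icc, Real.volume_Icc, Real.volume_Icc, one_mul,
      ← ENNReal.ofReal_mul hc0, ← ENNReal.ofReal_mul hc0,
      ← ENNReal.ofReal_add (by linarith) (by nlinarith),
      ← ENNReal.ofReal_add (by nlinarith) (by nlinarith),
      ← ENNReal.ofReal_mul (by nlinarith)]
    refine ENNReal.ofReal_le_ofReal (le_of_eq ?_)
    ring

/-! ### Boundary behaviour of the conformal map and the lower bound -/

theorem Complex.exp_mem_upperHalfPlane {s : ℂ} (hs : s ∈ strip) : 0 < (Complex.exp s).im := by
  rw [Complex.exp_im]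
  exact mul_pos (Real.exp_pos _) (Real.sin_pos_of_pos_of_lt_pi hs.1 hs.2)

theorem Complex.log_mem_strip {z : ℂ} (hz : 0 < z.im) : Complex.log z ∈ strip := by
  rw [strip, mem_ofPred_eq, Complex.log_im]
  refine ⟨(Complex.arg_nonneg_iff.2 hz.le).lt_of_ne' fun h => ?_, (Complex.arg_le_pi z).lt_of_ne
    fun h => ?_⟩
  · exact hz.ne' (Complex.arg_eq_zero_iff.1 h).2
  · exact hz.ne' (Complex.arg_eq_pi_iff.1 h).2

theorem isOpen_upperHalfPlane : IsOpen {z : ℂ | 0 < z.im} :=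
  isOpen_lt continuous_const Complex.continuous_im

namespace IsSchwarzChristoffelMap

variable {L : Fin 4 → Set ℂ} {x : Fin 4 → ℂ} {ζ : ℝ} {w : ℂ → ℂ}
  (hw : IsSchwarzChristoffelMap L x ζ w)
include hw

/-- Boundary behaviour of the inverse of the Schwarz–Christoffel map: as the closed half plane with
`∞` is compact, the preimages of points converging to a boundary point `q₀` (other than the image
of `∞`) cluster only at real points that are mapped to `q₀`. -/
theorem tendsto_comp_invFunOn {q₀ : ℂ} (hq₀ : q₀ ∉ interior (convexHull ℝ (range x)))
    (hq₁ : q₀ ≠ x 1) {F : Filter ℂ} (hF : F ≤ 𝓝 q₀ ⊓ 𝓟 (interior (convexHull ℝ (range x))))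
    {G : ℂ → ℝ} {c : ℝ}
    (hG : ∀ t : ℝ, w t = q₀ → Tendsto G (𝓝[{z | 0 < z.im}] (t : ℂ)) (𝓝 c)) :
    Tendsto (fun q => G (Function.invFunOn w {z | 0 < z.im} q)) F (𝓝 c) := by
  set g := Function.invFunOn w {z | 0 < z.im} with hg
  rw [tendsto_iff_ultrafilter]
  intro u hu
  have hu' := hu.trans hF
  have huΩ : interior (convexHull ℝ (range x)) ∈ (u : Filter ℂ) :=
    le_principal_iff.1 (hu'.trans inf_le_right)
  have hgH : ∀ q ∈ interior (convexHull ℝ (range x)), 0 < (g q).im ∧ w (g q) = q := fun q hq =>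
    ⟨hw.bijective.surjOn.mapsTo_invFunOn hq, hw.bijective.surjOn.rightInvOn_invFunOn hq⟩
  have hwg : Tendsto w (u.map g : Filter ℂ) (𝓝 q₀) := by
    rw [Ultrafilter.coe_map, tendsto_map'_iff]
    refine Tendsto.congr' ?_ (hu'.trans inf_le_left)
    filter_upwards [huΩ] with q hq using (hgH q hq).2.symm
  have hH : {z : ℂ | 0 < z.im} ∈ (u.map g : Filter ℂ) := by
    rw [Ultrafilter.coe_map, mem_map]
    filter_upwards [huΩ] with q hq using (hgH q hq).1
  have hH' : (u.map g : Filter ℂ) ≤ 𝓟 {z | 0 ≤ z.im} :=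
    le_principal_iff.2 (mem_of_superset hH fun z (hz : 0 < z.im) => hz.le)
  have hbdd : ∃ R : ℝ, Metric.closedBall (0 : ℂ) R ∈ (u.map g : Filter ℂ) := by
    by_contra hR
    push Not at hR
    have hcob : (u.map g : Filter ℂ) ≤ Bornology.cobounded ℂ := by
      rw [(Metric.hasBasis_cobounded_compl_closedBall (0 : ℂ)).ge_iff]
      exact fun R _ => Ultrafilter.compl_mem_iff_notMem.2 (hR R)
    exact hq₁ (tendsto_nhds_unique hwg (hw.map_infty.mono_left (le_inf hcob hH')))
  obtain ⟨R, hR⟩ := hbdd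
  obtain ⟨z₀, -, hz₀⟩ := (isCompact_closedBall (0 : ℂ) R).ultrafilter_le_nhds (u.map g)
    (le_principal_iff.2 hR)
  have hz₀im : 0 ≤ z₀.im := by
    have him : Tendsto Complex.im (u.map g : Filter ℂ) (𝓝 z₀.im) :=
      (Complex.continuous_im.tendsto z₀).mono_left hz₀
    exact ge_of_tendsto him (le_principal_iff.1 hH')
  have hwz₀ : w z₀ = q₀ :=
    tendsto_nhds_unique ((hw.continuous z₀ hz₀im).tendsto.mono_left (le_inf hz₀ hH')) hwg
  rcases hz₀im.eq_or_lt with h0 | h0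
  · have hreal : (z₀.re : ℂ) = z₀ := Complex.ext (by simp) (by simpa using h0)
    have := (hG z₀.re (by rw [hreal]; exact hwz₀)).mono_left
      (by rw [hreal]; exact le_inf hz₀ (le_principal_iff.2 hH) : (u.map g : Filter ℂ) ≤ _)
    rwa [Ultrafilter.coe_map, tendsto_map'_iff] at this
  · exact absurd (hwz₀ ▸ hw.bijective.mapsTo h0) hq₀

theorem preimage_mem_Ioo_of_side_zero {t : ℝ} (h1 : w t ∉ L 1) (h2 : w t ∉ L 2) (h3 : w t ∉ L 3)
    (hx : ∀ i, w t ≠ x i) : t ∈ Ioo ζ 1 := by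
  have hζ := hw.zeta_mem
  refine ⟨?_, ?_⟩
  · by_contra hc
    rcases (not_lt.1 hc).lt_or_eq with hlt | rfl
    · rcases lt_trichotomy t 0 with ht | rfl | ht
      · exact h2 (hw.side_two t ht)
      · exact hx 2 (by simpa using hw.map_zero)
      · exact h3 (hw.side_three t ⟨ht, hlt⟩)
    · exact hx 3 hw.map_zeta
  · by_contra hc
    rcases (not_lt.1 hc).lt_or_eq with hlt | rfl
    · exact h1 (hw.side_one t hlt)
    · exact hx 0 (by simpa using hw.map_one)

theorem preimage_mem_Iio_of_side_two {t : ℝ} (h0 : w t ∉ L 0) (h1 : w t ∉ L 1) (h3 : w t ∉ L 3)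
    (hx : ∀ i, w t ≠ x i) : t < 0 := by
  have hζ := hw.zeta_mem
  by_contra hc
  rcases (not_lt.1 hc).lt_or_eq with hlt | rfl
  · rcases lt_trichotomy t ζ with ht | rfl | ht
    · exact h3 (hw.side_three t ⟨hlt, ht⟩)
    · exact hx 3 hw.map_zeta
    · rcases lt_trichotomy t 1 with ht' | rfl | ht'
      · exact h0 (hw.side_zero t ⟨ht, ht'⟩)
      · exact hx 0 (by simpa using hw.map_one)
      · exact h1 (hw.side_one t ht')
  · exact hx 2 (by simpa using hw.map_zero)

/-- The boundary values of the Schwarz–Christoffel map lie in the closed quadrilateral. -/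
theorem map_ofReal_mem_convexHull (t : ℝ) : w t ∈ convexHull ℝ (range x) := by
  have hcl : IsClosed (convexHull ℝ (range x)) :=
    ((finite_range x).isCompact_convexHull (𝕜 := ℝ)).isClosed
  have hne : (𝓝[{z : ℂ | 0 < z.im}] (t : ℂ)).NeBot := by
    rw [← mem_closure_iff_nhdsWithin_neBot, Complex.closure_setOfPred_lt_im]
    simp
  have hlim : Tendsto w (𝓝[{z : ℂ | 0 < z.im}] (t : ℂ)) (𝓝 (w t)) :=
    (hw.continuous (t : ℂ) (by simp)).tendsto.mono_left
      (nhdsWithin_mono _ fun z (hz : 0 < z.im) => hz.le)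
  refine hcl.mem_of_tendsto hlim ?_
  filter_upwards [self_mem_nhdsWithin] with z hz using
    interior_subset (hw.bijective.mapsTo hz)

end IsSchwarzChristoffelMap

theorem continuous_sliceAffine {A B : ℝ → ℝ} (hA : Continuous A) (hB : Continuous B) :
    Continuous (sliceAffine A B) :=
  (hA.comp Complex.continuous_re).add
    ((hB.comp Complex.continuous_re).mul Complex.continuous_im)

theorem tendsto_mk_left (x c : ℝ) (s : Set ℝ) :
    Tendsto (fun y : ℝ => (⟨x, y⟩ : ℂ)) (𝓝[s] c) (𝓝 ⟨x, c⟩) := by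
  have : Continuous fun y : ℝ => (⟨x, y⟩ : ℂ) := by
    rw [show (fun y : ℝ => (⟨x, y⟩ : ℂ)) = fun y : ℝ => (x : ℂ) + (y : ℂ) * Complex.I from
      funext (Complex.mk_eq_add_mul_I x)]
    fun_prop
  exact this.continuousWithinAt.tendsto

theorem lintegral_ofReal_const_div_eq {α β : ℝ} (hαβ : α ≤ β) {g : ℝ → ℝ} (hg : Continuous g)
    (hpos : ∀ x ∈ Icc α β, 0 < g x) {c : ℝ} (hc : 0 ≤ c) :
    ∫⁻ x in Ioo α β, ENNReal.ofReal (c / g x) = ENNReal.ofReal (c * ∫ x in α..β, 1 / g x) := by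
  rw [← intervalIntegral.integral_const_mul, intervalIntegral.integral_of_le hαβ,
    ofReal_integral_eq_lintegral_ofReal, restrict_Ioo_eq_restrict_Ioc]
  · simp only [mul_one_div]
  · refine IntegrableOn.mono_set ?_ Ioc_subset_Icc_self
    exact (continuousOn_const.mul (continuousOn_const.div hg.continuousOn
      fun x hx => (hpos x hx).ne')).integrableOn_Icc
  · filter_upwards [self_mem_ae_restrict measurableSet_Ioc] with x hx
    exact mul_nonneg hc (one_div_nonneg.2 (hpos x ⟨hx.1.le, hx.2⟩).le)

/-- No vertex lies over the open middle region. -/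
theorem ne_of_mem_Ioo_max_min {p : Fin 4 → ℝ} {x : ℝ}
    (hx : x ∈ Ioo (max (p 0) (p 1)) (min (p 2) (p 3))) (i : Fin 4) : x ≠ p i := by
  obtain ⟨h1, h2⟩ := hx
  rw [max_lt_iff] at h1
  rw [lt_min_iff] at h2
  fin_cases i
  · exact h1.1.ne'
  · exact h1.2.ne'
  · exact h2.1.ne
  · exact h2.2.ne

namespace IsLeftRightQuadrilateral

variable {a b p : Fin 4 → ℝ} (h : IsLeftRightQuadrilateral a b p)
include h

theorem line_ne_line_succ (i : Fin 4) {x : ℝ} (hx : x ≠ p i) :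
    a (i + 1) * x + b (i + 1) ≠ a i * x + b i := fun e => by
  have hm := h.meet i
  have ha : a (i + 1) - a i = 0 := by
    have : (a (i + 1) - a i) * (x - p i) = 0 := by linear_combination e - hm
    exact (mul_eq_zero.1 this).resolve_right (sub_ne_zero.2 hx)
  have ht := h.turn (i + 3)
  have e1 : i + 3 + 1 = i := by fin_cases i <;> rfl
  have e2 : i + 3 + 2 = i + 1 := by fin_cases i <;> rfl
  rw [e2, e1, ha, mul_zero] at ht
  exact lt_irrefl _ ht

/-- Lower bound for `-log ζ`: the vertical segments over the middle region of the quadrilateral are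
compared, in the strip, with the cut-off harmonic measure of the top side. -/
theorem exists_lower_bound : ∃ C, ∀ ε > 0, ∀ ζ w,
    IsSchwarzChristoffelMap (thinLine a b ε) (thinVertex a b p ε) ζ w →
    Real.pi * (∫ x in max (p 0) (p 1)..min (p 2) (p 3), 1 / gap a b x) / ε ≤
      -Real.log ζ + C := by
  obtain ⟨C, hC⟩ := exists_strip_energy_le
  refine ⟨max C 0 / Real.pi, fun ε hε ζ w hw => ?_⟩
  set α := max (p 0) (p 1) with hα
  set β := min (p 2) (p 3) with hβ
  have hζ := hw.zeta_mem
  set u := Real.log ζ with hu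
  have hu0 : u ≤ 0 := Real.log_nonpos hζ.1.le hζ.2.le
  set A : ℝ → ℝ := fun x => Real.pi * (1 - plateau 1 u 0 x) with hA
  set B : ℝ → ℝ := plateau 1 u 0 with hB
  have hBc : ContDiff ℝ 1 B := contDiff_plateau 1 u 0
  have hAc : ContDiff ℝ 1 A := contDiff_const.mul (contDiff_const.sub hBc)
  set Ω := interior (convexHull ℝ (range (thinVertex a b p ε))) with hΩ
  set g := Function.invFunOn w {z | 0 < z.im} with hg
  set U : Set ℂ := {z | z.re ∈ Ioo α β ∧
    z.im ∈ Ioo (ε * (a 2 * z.re + b 2)) (ε * (a 0 * z.re + b 0))} with hU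
  have hUΩ : U ⊆ Ω := fun z hz => h.mem_interior_of_middle ε hz.1 hz.2.1 hz.2.2
  have hgH : ∀ q ∈ Ω, 0 < (g q).im ∧ w (g q) = q := fun q hq =>
    ⟨hw.bijective.surjOn.mapsTo_invFunOn hq, hw.bijective.surjOn.rightInvOn_invFunOn hq⟩
  -- the map from the quadrilateral to the strip is `log ∘ g`
  have hgd : DifferentiableOn ℂ g Ω := by
    have := differentiableOn_of_leftInvOn isOpen_upperHalfPlane hw.holomorphic
      hw.bijective.injOn.leftInvOn_invFunOn
    rwa [hw.bijective.image_eq] at this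
  have hslit : ∀ q ∈ Ω, g q ∈ Complex.slitPlane := fun q hq => .inr (hgH q hq).1.ne'
  have hmain := length_area_inequality hAc hBc (α := α) (β := β)
    (a := fun x => ε * (a 2 * x + b 2)) (b := fun x => ε * (a 0 * x + b 0))
    (by fun_prop) (by fun_prop) (fun x hx => ?_) (φ := fun q => Complex.log (g q)) (U := U)
    (Ω := strip) rfl (fun q hq => ?_) (fun q hq q' hq' e => ?_)
    (fun q hq => Complex.log_mem_strip (hgH q (hUΩ hq)).1) (c₀ := Real.pi) (c₁ := 0)
    (fun x hx => ?_) (fun x hx => ?_)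
  · have key := hmain.trans (hC u hu0)
    have e : ∀ x, (0 - Real.pi) ^ 2 / (ε * (a 0 * x + b 0) - ε * (a 2 * x + b 2)) =
        (Real.pi ^ 2 / ε) / gap a b x := fun x => by
      rw [div_div, gap]; congr 1 <;> ring
    simp only [e] at key
    rw [lintegral_ofReal_const_div_eq h.max_lt_min.le (continuous_gap a b)
      (fun x hx => h.gap_pos_of_mem_Icc hx) (by positivity)] at key
    have key' := key.trans (ENNReal.ofReal_le_ofReal
      (add_le_add_right (le_max_left C 0) (Real.pi * -u)))
    rw [ENNReal.ofReal_le_ofReal_iff (add_nonneg (mul_nonneg Real.pi_pos.le (by linarith))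
      (le_max_right _ _))] at key'
    have hpi := Real.pi_pos
    rw [← mul_le_mul_iff_of_pos_left hpi]
    calc _ = Real.pi ^ 2 / ε * ∫ x in α..β, 1 / gap a b x := by ring
      _ ≤ _ := key'
      _ = _ := by field_simp
  · have := h.gap_pos_of_mem_Icc ⟨hx.1.le, hx.2.le⟩
    rw [gap] at this
    nlinarith
  · exact ((hgd.differentiableAt (isOpen_interior.mem_nhds (hUΩ hq))).clog
      (hslit q (hUΩ hq))).differentiableWithinAt
  · have h1 : g q = g q' := by
      have e' : Complex.exp (Complex.log (g q)) = Complex.exp (Complex.log (g q')) :=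
        congrArg Complex.exp e
      rwa [Complex.exp_log (Complex.slitPlane_ne_zero (hslit q (hUΩ hq))),
        Complex.exp_log (Complex.slitPlane_ne_zero (hslit q' (hUΩ hq')))] at e'
    rw [← (hgH q (hUΩ hq)).2, h1, (hgH q' (hUΩ hq')).2]
  · have hgap := h.gap_pos_of_mem_Icc ⟨hx.1.le, hx.2.le⟩
    have hlow : ε * (a 2 * x + b 2) < ε * (a 0 * x + b 0) := by rw [gap] at hgap; nlinarith
    have hne := ne_of_mem_Ioo_max_min hx
    set q₀ : ℂ := ⟨x, ε * (a 2 * x + b 2)⟩ with hq₀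
    have hqx : ∀ i, q₀ ≠ thinVertex a b p ε i := fun i e => hne i (congrArg Complex.re e)
    have hF : map (fun y : ℝ => (⟨x, y⟩ : ℂ)) (𝓝[>] (ε * (a 2 * x + b 2))) ≤ 𝓝 q₀ ⊓ 𝓟 Ω := by
      refine le_inf (tendsto_mk_left x _ _) (le_principal_iff.2 ?_)
      rw [mem_map]
      filter_upwards [Ioo_mem_nhdsGT hlow] with y hy using hUΩ ⟨hx, hy⟩
    refine (tendsto_map'_iff (f := fun q => sliceAffine A B (Complex.log (g q)))).1
      (hw.tendsto_comp_invFunOn (h.thinLine_two_notMem_interior hε rfl) (hqx 1) hF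
        (G := fun s => sliceAffine A B (Complex.log s)) fun t ht => ?_)
    have ht0 : t < 0 := by
      apply hw.preimage_mem_Iio_of_side_two <;> rw [ht]
      · exact hlow.ne
      · exact fun e => h.line_ne_line_succ 1 (hne 1) (mul_left_cancel₀ hε.ne' e)
      · exact fun e => h.line_ne_line_succ 2 (hne 2) (mul_left_cancel₀ hε.ne' e.symm)
      · exact hqx
    have hlog : Tendsto Complex.log (𝓝[{z | 0 < z.im}] (t : ℂ)) (𝓝 (Complex.log t)) :=
      (Complex.continuousWithinAt_log_of_re_neg_of_im_zero (by simpa using ht0)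
        (by simp)).tendsto.mono_left (nhdsWithin_mono _ fun z (hz : 0 < z.im) => hz.le)
    have := ((continuous_sliceAffine hAc.continuous hBc.continuous).tendsto _).comp hlog
    have hval : sliceAffine A B (Complex.log t) = Real.pi := by
      rw [sliceAffine, Complex.log_im, Complex.arg_ofReal_of_neg ht0, hA]
      ring
    rwa [hval] at this
  · have hgap := h.gap_pos_of_mem_Icc ⟨hx.1.le, hx.2.le⟩
    have hlow : ε * (a 2 * x + b 2) < ε * (a 0 * x + b 0) := by rw [gap] at hgap; nlinarith
    have hne := ne_of_mem_Ioo_max_min hx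
    set q₀ : ℂ := ⟨x, ε * (a 0 * x + b 0)⟩ with hq₀
    have hqx : ∀ i, q₀ ≠ thinVertex a b p ε i := fun i e => hne i (congrArg Complex.re e)
    have hF : map (fun y : ℝ => (⟨x, y⟩ : ℂ)) (𝓝[<] (ε * (a 0 * x + b 0))) ≤ 𝓝 q₀ ⊓ 𝓟 Ω := by
      refine le_inf (tendsto_mk_left x _ _) (le_principal_iff.2 ?_)
      rw [mem_map]
      filter_upwards [Ioo_mem_nhdsLT hlow] with y hy using hUΩ ⟨hx, hy⟩
    refine (tendsto_map'_iff (f := fun q => sliceAffine A B (Complex.log (g q)))).1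
      (hw.tendsto_comp_invFunOn (h.thinLine_zero_notMem_interior hε rfl) (hqx 1) hF
        (G := fun s => sliceAffine A B (Complex.log s)) fun t ht => ?_)
    have ht1 : t ∈ Ioo ζ 1 := by
      apply hw.preimage_mem_Ioo_of_side_zero <;> rw [ht]
      · exact fun e => h.line_ne_line_succ 0 (hne 0) (mul_left_cancel₀ hε.ne' e.symm)
      · exact hlow.ne'
      · exact fun e => h.line_ne_line_succ 3 (hne 3) (mul_left_cancel₀ hε.ne' e)
      · exact hqx
    have ht0 : 0 < t := hζ.1.trans ht1.1
    have hlog : Tendsto Complex.log (𝓝[{z | 0 < z.im}] (t : ℂ)) (𝓝 (Complex.log t)) :=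
      (continuousAt_clog (Complex.ofReal_mem_slitPlane.2 ht0)).tendsto.mono_left
        nhdsWithin_le_nhds
    have := ((continuous_sliceAffine hAc.continuous hBc.continuous).tendsto _).comp hlog
    have hone : B (Real.log t) = 1 := plateau_eq_one one_pos
      ⟨Real.log_le_log hζ.1 ht1.1.le, Real.log_nonpos ht0.le ht1.2.le⟩
    have hval : sliceAffine A B (Complex.log t) = 0 := by
      rw [sliceAffine, Complex.log_im, Complex.arg_ofReal_of_nonneg ht0.le, Complex.log_ofReal_re,
        hA]
      simp only [hone]
      ring
    rwa [hval] at this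

end IsLeftRightQuadrilateral

/-! ### The upper bound -/

namespace IsLeftRightQuadrilateral

variable {a b p : Fin 4 → ℝ} (h : IsLeftRightQuadrilateral a b p)
include h

theorem exists_pos_le_gap : ∃ m > 0, ∃ δ > 0,
    ∀ x ∈ Icc (max (p 0) (p 1) - δ) (min (p 2) (p 3) + δ), m ≤ gap a b x := by
  have h1 := h.gap_max_pos
  have h2 := h.gap_min_pos
  set α := max (p 0) (p 1)
  set β := min (p 2) (p 3)
  have hαβ : α < β := h.max_lt_min
  -- over a distance `m / (2 * k)` the gap, whose slope is at most `k`, changes by at most `m / 2`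
  set k := |a 0 - a 2| + 1 with hk
  have hk0 : 0 < k := by positivity
  have hk1 : a 0 - a 2 ≤ k := (le_abs_self _).trans (by linarith)
  have hk2 : -k ≤ a 0 - a 2 := by linarith [neg_abs_le (a 0 - a 2)]
  set m := min (gap a b α) (gap a b β) with hm
  have hm0 : 0 < m := lt_min h1 h2
  refine ⟨m / 2, by positivity, m / (2 * k), by positivity, fun x hx => ?_⟩
  have e1 : m ≤ gap a b α := min_le_left _ _
  have e2 : m ≤ gap a b β := min_le_right _ _
  have hkm : k * (m / (2 * k)) = m / 2 := by field_simp
  obtain ⟨hx1, hx2⟩ := hx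
  unfold gap at *
  rcases le_or_gt x α with c1 | c1
  · nlinarith
  rcases le_or_gt β x with c2 | c2
  · nlinarith
  rcases le_total 0 (a 0 - a 2) with hs | hs <;> nlinarith

theorem exists_integral_inv_gap_le {η : ℝ} (hη : 0 < η) : ∃ δ > 0,
    (∀ x ∈ Icc (max (p 0) (p 1) - δ) (min (p 2) (p 3) + δ), 0 < gap a b x) ∧
    ∫ x in (max (p 0) (p 1) - δ)..(min (p 2) (p 3) + δ), 1 / gap a b x ≤
      (∫ x in max (p 0) (p 1)..min (p 2) (p 3), 1 / gap a b x) + η := by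
  obtain ⟨m, hm, δ₀, hδ₀, hgap⟩ := h.exists_pos_le_gap
  set α := max (p 0) (p 1)
  set β := min (p 2) (p 3)
  have hαβ : α < β := h.max_lt_min
  -- each of the two additional intervals contributes at most `δ / m ≤ η / 2`
  set δ := min δ₀ (η * m / 2) with hδ
  have hδ0 : 0 < δ := lt_min hδ₀ (by positivity)
  have hδ1 : δ ≤ δ₀ := min_le_left _ _
  have hδ2 : δ ≤ η * m / 2 := min_le_right _ _
  have hg : ∀ x ∈ Icc (α - δ) (β + δ), m ≤ gap a b x := fun x hx =>
    hgap x ⟨by linarith [hx.1], by linarith [hx.2]⟩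
  refine ⟨δ, hδ0, fun x hx => hm.trans_le (hg x hx), ?_⟩
  have hcont : ContinuousOn (fun x => 1 / gap a b x) (Icc (α - δ) (β + δ)) :=
    continuousOn_const.div (continuous_gap a b).continuousOn
      fun x hx => (hm.trans_le (hg x hx)).ne'
  have hint : ∀ s ∈ Icc (α - δ) (β + δ), ∀ t ∈ Icc (α - δ) (β + δ), s ≤ t →
      IntervalIntegrable (fun x => 1 / gap a b x) volume s t := fun s hs t ht hst =>
    (hcont.mono (by rw [uIcc_of_le hst]; exact Icc_subset_Icc hs.1 ht.2)).intervalIntegrable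
  have hsmall : ∀ s t, s ∈ Icc (α - δ) (β + δ) → t ∈ Icc (α - δ) (β + δ) → t = s + δ →
      ∫ x in s..t, 1 / gap a b x ≤ η / 2 := fun s t hs ht hst => by
    calc ∫ x in s..t, 1 / gap a b x ≤ ∫ x in s..t, 1 / m := by
          refine intervalIntegral.integral_mono_on (by linarith) (hint s hs t ht (by linarith))
            intervalIntegrable_const fun x hx => ?_
          exact one_div_le_one_div_of_le hm (hg x ⟨hs.1.trans hx.1, hx.2.trans ht.2⟩)
      _ = δ / m := by
          rw [intervalIntegral.integral_const, hst, smul_eq_mul]; ring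
      _ ≤ η / 2 := by rw [div_le_iff₀ hm]; linarith
  have m1 : α - δ ∈ Icc (α - δ) (β + δ) := ⟨le_rfl, by linarith⟩
  have m2 : α ∈ Icc (α - δ) (β + δ) := ⟨by linarith, by linarith⟩
  have m3 : β ∈ Icc (α - δ) (β + δ) := ⟨by linarith, by linarith⟩
  have m4 : β + δ ∈ Icc (α - δ) (β + δ) := ⟨by linarith, le_rfl⟩
  rw [← intervalIntegral.integral_add_adjacent_intervals
      (hint _ m1 _ m3 (by linarith)) (hint _ m3 _ m4 (by linarith)),
    ← intervalIntegral.integral_add_adjacent_intervals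
      (hint _ m1 _ m2 (by linarith)) (hint _ m2 _ m3 (by linarith))]
  have s1 := hsmall _ _ m1 m2 (by ring)
  have s2 := hsmall _ _ m3 m4 rfl
  linarith

/-- A cut-off version of the reciprocal of the gap is smooth, since the cut-off vanishes near the
point where the lines `0` and `2` meet. -/
theorem contDiff_plateau_div_gap {δ : ℝ} (hδ : 0 < δ)
    (hgap : ∀ x ∈ Icc (max (p 0) (p 1) - δ) (min (p 2) (p 3) + δ), 0 < gap a b x) :
    ContDiff ℝ 1 fun x =>
      plateau δ (max (p 0) (p 1)) (min (p 2) (p 3)) x / gap a b x := by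
  have hg : ContDiff ℝ 1 (gap a b) := by unfold gap; fun_prop
  refine contDiff_iff_contDiffAt.2 fun x => ?_
  by_cases hx : gap a b x = 0
  · have hloc : ∀ᶠ t in 𝓝 x,
        plateau δ (max (p 0) (p 1)) (min (p 2) (p 3)) t / gap a b t = 0 := by
      have hx' : x ∈ (Icc (max (p 0) (p 1) - δ) (min (p 2) (p 3) + δ))ᶜ := fun hmem =>
        (hgap x hmem).ne' hx
      filter_upwards [isClosed_Icc.isOpen_compl.mem_nhds hx'] with t ht
      rw [mem_compl_iff, mem_Icc, not_and_or, not_le, not_le] at ht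
      rw [plateau_eq_zero hδ h.max_lt_min.le (ht.imp le_of_lt le_of_lt), zero_div]
    exact contDiffAt_const.congr_of_eventuallyEq hloc
  · exact (contDiff_plateau _ _ _).contDiffAt.div hg.contDiffAt hx

/-- Upper bound for the energy of the cut-off of the affine interpolation between the lines `2` and
`0`, compressed vertically by `ε`. -/
theorem exists_energy_le {δ : ℝ} (hδ : 0 < δ)
    (hgap : ∀ x ∈ Icc (max (p 0) (p 1) - δ) (min (p 2) (p 3) + δ), 0 < gap a b x)
    {A B : ℝ → ℝ} (hA : ContDiff ℝ 1 A) (hB : ContDiff ℝ 1 B)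
    (hBdef : ∀ x, B x = plateau δ (max (p 0) (p 1)) (min (p 2) (p 3)) x / gap a b x) :
    ∃ C, ∀ ε > 0, ∫⁻ z in interior (convexHull ℝ (range (thinVertex a b p ε))),
      ENNReal.ofReal (sliceAffineEnergy A (fun x => B x / ε) z) ≤
      ENNReal.ofReal ((∫ x in (max (p 0) (p 1) - δ)..(min (p 2) (p 3) + δ), 1 / gap a b x) / ε +
        C * ε) := by
  set α := max (p 0) (p 1)
  set β := min (p 2) (p 3)
  have hαβ : α < β := h.max_lt_min
  set μ := min (p 0) (p 1) with hμ
  set M := max (p 2) (p 3) with hM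
  have hμM : μ ≤ M := min_le_max.trans (hαβ.le.trans min_le_max)
  have hbound : ∀ f : ℝ → ℝ, Continuous f → ∃ K ≥ 0, ∀ x ∈ Icc μ M, |f x| ≤ K := fun f hf => by
    obtain ⟨K, hK⟩ := isCompact_Icc.exists_bound_of_continuousOn (hf.continuousOn (s := Icc μ M))
    exact ⟨max K 0, le_max_right _ _, fun x hx => (hK x hx).trans (le_max_left _ _)⟩
  obtain ⟨K₁, hK₁0, hK₁⟩ := hbound _ (hA.continuous_deriv le_rfl)
  obtain ⟨K₂, hK₂0, hK₂⟩ := hbound _ (hB.continuous_deriv le_rfl)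
  obtain ⟨Y₀, hY₀0, hY₀⟩ := hbound (fun x => a 0 * x + b 0) (by fun_prop)
  obtain ⟨Y₂, hY₂0, hY₂⟩ := hbound (fun x => a 2 * x + b 2) (by fun_prop)
  obtain ⟨G, hG0, hG⟩ := hbound _ (continuous_gap a b)
  set C₁ := (K₁ + K₂ * (Y₀ + Y₂)) ^ 2 with hC₁
  have hC₁0 : 0 ≤ C₁ := sq_nonneg _
  refine ⟨C₁ * G * (M - μ), fun ε hε => ?_⟩
  have hplat : ∀ x, x ∉ Icc (α - δ) (β + δ) → B x = 0 := fun x hx => by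
    rw [mem_Icc, not_and_or, not_le, not_le] at hx
    rw [hBdef, plateau_eq_zero hδ hαβ.le (hx.imp le_of_lt le_of_lt), zero_div]
  set J := Icc (α - δ) (β + δ) with hJ
  refine (Complex.setLIntegral_le_of_slices isOpen_interior.measurableSet
    (X := Icc μ M) measurableSet_Icc
    (lo := fun x => ε * (a 2 * x + b 2)) (hi := fun x => ε * (a 0 * x + b 0)) (by fun_prop)
    (by fun_prop) (fun z hz => ?_) (e := fun x => ENNReal.ofReal (C₁ + (B x / ε) ^ 2)) ?_
    (fun z hz => ?_)).trans ?_
  · have hb := h.thin_bounds hε (interior_subset hz)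
    exact ⟨hb.2.2, hb.1⟩
  · have := hB.continuous
    exact ENNReal.measurable_ofReal.comp (by fun_prop)
  · obtain ⟨⟨hb1, hb2⟩, -, hb3⟩ := h.thin_bounds hε (interior_subset hz)
    refine ENNReal.ofReal_le_ofReal ?_
    have hd : deriv (fun x => B x / ε) z.re = deriv B z.re / ε :=
      ((hB.differentiable one_ne_zero z.re).hasDerivAt.div_const ε).deriv
    rw [sliceAffineEnergy, hd]
    refine add_le_add_left ?_ _
    have hy : |z.im / ε| ≤ Y₀ + Y₂ := by
      have y0 := abs_le.1 (hY₀ z.re hb3)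
      have y2 := abs_le.1 (hY₂ z.re hb3)
      have l1 : a 2 * z.re + b 2 ≤ z.im / ε := by rw [le_div_iff₀ hε]; linarith
      have l2 : z.im / ε ≤ a 0 * z.re + b 0 := by rw [div_le_iff₀ hε]; linarith
      exact abs_le.2 ⟨by linarith, by linarith⟩
    have habs : |deriv A z.re + deriv B z.re / ε * z.im| ≤ K₁ + K₂ * (Y₀ + Y₂) := by
      have e : deriv B z.re / ε * z.im = deriv B z.re * (z.im / ε) := by ring
      rw [e]
      refine (abs_add_le _ _).trans (add_le_add (hK₁ _ hb3) ?_)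
      rw [abs_mul]
      exact mul_le_mul (hK₂ _ hb3) hy (abs_nonneg _) hK₂0
    rw [hC₁, ← sq_abs]
    exact pow_le_pow_left₀ (abs_nonneg _) habs 2
  · have hpt : ∀ x ∈ Icc μ M, ENNReal.ofReal (C₁ + (B x / ε) ^ 2) *
        ENNReal.ofReal (ε * (a 0 * x + b 0) - ε * (a 2 * x + b 2)) ≤
        ENNReal.ofReal (C₁ * G * ε) +
          J.indicator (fun x => ENNReal.ofReal ((1 / ε) / gap a b x)) x := fun x hx => by
      have e : ε * (a 0 * x + b 0) - ε * (a 2 * x + b 2) = ε * gap a b x := by rw [gap]; ring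
      rw [e]
      rcases le_or_gt (gap a b x) 0 with hg | hg
      · rw [ENNReal.ofReal_of_nonpos (mul_nonpos_of_nonneg_of_nonpos hε.le hg), mul_zero]
        exact zero_le
      have hGx := (abs_le.1 (hG x hx)).2
      rw [← ENNReal.ofReal_mul (by positivity), add_mul, ENNReal.ofReal_add (by positivity)
        (by positivity)]
      refine add_le_add (ENNReal.ofReal_le_ofReal ?_) ?_
      · calc C₁ * (ε * gap a b x) ≤ C₁ * (ε * G) := by gcongr
          _ = _ := by ring
      · by_cases hxJ : x ∈ J
        · rw [indicator_of_mem hxJ]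
          refine ENNReal.ofReal_le_ofReal ?_
          have hp1 : plateau δ α β x ^ 2 ≤ 1 :=
            pow_le_one₀ (plateau_nonneg hδ hαβ.le) plateau_le_one
          rw [hBdef]
          have e : (plateau δ α β x / gap a b x / ε) ^ 2 * (ε * gap a b x) =
              plateau δ α β x ^ 2 * (1 / ε / gap a b x) := by field_simp
          rw [e]
          exact mul_le_of_le_one_left (by positivity) hp1
        · rw [indicator_of_notMem hxJ, hplat x hxJ]; simp
    calc _ ≤ ∫⁻ x in Icc μ M, (ENNReal.ofReal (C₁ * G * ε) +
          J.indicator (fun x => ENNReal.ofReal ((1 / ε) / gap a b x)) x) :=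
        setLIntegral_mono' measurableSet_Icc hpt
      _ = ENNReal.ofReal (C₁ * G * ε) * ENNReal.ofReal (M - μ) +
          ∫⁻ x in Icc μ M, J.indicator (fun x => ENNReal.ofReal ((1 / ε) / gap a b x)) x := by
        rw [lintegral_add_left measurable_const, setLIntegral_const, Real.volume_Icc]
      _ ≤ ENNReal.ofReal (C₁ * G * ε) * ENNReal.ofReal (M - μ) +
          ∫⁻ x in J, ENNReal.ofReal ((1 / ε) / gap a b x) := by
        refine add_le_add_right ?_ _
        refine (setLIntegral_le_lintegral _ _).trans (le_of_eq ?_)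
        rw [lintegral_indicator measurableSet_Icc]
      _ = _ := by
        rw [hJ, ← restrict_Ioo_eq_restrict_Icc,
          lintegral_ofReal_const_div_eq (by linarith) (continuous_gap a b) hgap (by positivity),
          ← ENNReal.ofReal_mul (by positivity), ← ENNReal.ofReal_add]
        · congr 1; ring
        · exact mul_nonneg (by positivity) (by linarith)
        · refine mul_nonneg (by positivity)
            (intervalIntegral.integral_nonneg (by linarith) fun x hx => ?_)
          exact one_div_nonneg.2 (hgap x hx).le

/-- Upper bound for `-log ζ`: the semicircles around `0` in the half plane, i.e. the vertical
segments in the strip, are compared with the affine interpolation between the top and bottom lines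
of the quadrilateral. Beyond the middle region only one of these two lines bounds the quadrilateral
(the upper one on the left if and only if `p 0 < p 1`), and the test function is cut off to the
value it has on that line. -/
theorem exists_upper_bound {η : ℝ} (hη : 0 < η) : ∃ C, ∀ ε > 0, ∀ ζ w,
    IsSchwarzChristoffelMap (thinLine a b ε) (thinVertex a b p ε) ζ w →
    -Real.log ζ ≤
      Real.pi * ((∫ x in max (p 0) (p 1)..min (p 2) (p 3), 1 / gap a b x) + η) / ε + C * ε := by
  obtain ⟨δ, hδ, hgap, hint⟩ := h.exists_integral_inv_gap_le hη
  have hBc' := h.contDiff_plateau_div_gap hδ hgap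
  set α := max (p 0) (p 1)
  set β := min (p 2) (p 3)
  have hαβ : α < β := h.max_lt_min
  set B : ℝ → ℝ := fun x => plateau δ α β x / gap a b x with hB
  set κl : ℝ := if p 0 < p 1 then 1 else 0 with hκl
  set κr : ℝ := if p 2 < p 3 then 1 else 0 with hκr
  set A : ℝ → ℝ := fun x => κl * (1 - stepUp δ α x) + κr * (1 - stepDown δ β x) -
    B x * (a 2 * x + b 2) with hA
  have hBc : ContDiff ℝ 1 B := hBc'
  have hAc : ContDiff ℝ 1 A := by
    have hl : ContDiff ℝ 1 fun x : ℝ => a 2 * x + b 2 := by fun_prop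
    exact ((contDiff_const.mul (contDiff_const.sub (contDiff_stepUp δ α))).add
      (contDiff_const.mul (contDiff_const.sub (contDiff_stepDown δ β)))).sub (hBc.mul hl)
  have hBgap : ∀ x, B x * gap a b x = plateau δ α β x := fun x => by
    by_cases hx : gap a b x = 0
    · have hx' : x ∉ Icc (α - δ) (β + δ) := fun hmem => (hgap x hmem).ne' hx
      rw [mem_Icc, not_and_or, not_le, not_le] at hx'
      rw [hx, mul_zero, plateau_eq_zero hδ hαβ.le (hx'.imp le_of_lt le_of_lt)]
    · rw [hB]; exact div_mul_cancel₀ _ hx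
  obtain ⟨C, hC⟩ := h.exists_energy_le hδ hgap hAc hBc fun _ => rfl
  refine ⟨Real.pi * max C 0, fun ε hε ζ w hw => ?_⟩
  have hζ := hw.zeta_mem
  set u := Real.log ζ with hu
  have hu0 : u < 0 := Real.log_neg hζ.1 hζ.2
  have hexp : ∀ x ∈ Ioo u 0, Real.exp x ∈ Ioo ζ 1 := fun x hx =>
    ⟨(Real.log_lt_iff_lt_exp hζ.1).1 hx.1, Real.exp_lt_one_iff.2 hx.2⟩
  have hBεc : ContDiff ℝ 1 fun x => B x / ε := hBc.div_const ε
  -- the boundary values of the test function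
  have hval0 : ∀ z ∈ thinLine a b ε 0, z ∈ convexHull ℝ (range (thinVertex a b p ε)) →
      sliceAffine A (fun x => B x / ε) z = 1 := fun z hz hzQ => by
    have e : sliceAffine A (fun x => B x / ε) z =
        κl * (1 - stepUp δ α z.re) + κr * (1 - stepDown δ β z.re) + B z.re * gap a b z.re := by
      rw [sliceAffine, show z.im = ε * (a 0 * z.re + b 0) from hz, hA, gap]
      field_simp
      ring
    have hl : κl * (1 - stepUp δ α z.re) = 1 - stepUp δ α z.re := by
      rcases h.left_cases with ⟨c, -⟩ | ⟨c, -⟩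
      · rw [hκl, if_pos c, one_mul]
      · rw [stepUp_eq_one hδ (h.max_le_re_of_mem_line_zero hε c hz hzQ)]; ring
    have hr : κr * (1 - stepDown δ β z.re) = 1 - stepDown δ β z.re := by
      rcases h.right_cases with ⟨c, -⟩ | ⟨c, -⟩
      · rw [hκr, if_pos c, one_mul]
      · rw [stepDown_eq_one hδ (h.re_le_min_of_mem_line_zero hε c hz hzQ)]; ring
    rw [e, hBgap, hl, hr, plateau]; ring
  have hval2 : ∀ z ∈ thinLine a b ε 2, z ∈ convexHull ℝ (range (thinVertex a b p ε)) →
      sliceAffine A (fun x => B x / ε) z = 0 := fun z hz hzQ => by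
    have e : sliceAffine A (fun x => B x / ε) z =
        κl * (1 - stepUp δ α z.re) + κr * (1 - stepDown δ β z.re) := by
      rw [sliceAffine, show z.im = ε * (a 2 * z.re + b 2) from hz, hA]
      field_simp
      ring
    have hl : κl * (1 - stepUp δ α z.re) = 0 := by
      rcases h.left_cases with ⟨c, -⟩ | ⟨c, -⟩
      · rw [stepUp_eq_one hδ (h.max_le_re_of_mem_line_two hε c hz hzQ)]; ring
      · rw [hκl, if_neg c.not_gt, zero_mul]
    have hr : κr * (1 - stepDown δ β z.re) = 0 := by
      rcases h.right_cases with ⟨c, -⟩ | ⟨c, -⟩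
      · rw [stepDown_eq_one hδ (h.re_le_min_of_mem_line_two hε c hz hzQ)]; ring
      · rw [hκr, if_neg c.not_gt, zero_mul]
    rw [e, hl, hr, add_zero]
  have hlim : ∀ (x y₀ : ℝ) (s : Set ℝ) (t : ℝ), Complex.exp ⟨x, y₀⟩ = t →
      (∀ᶠ y in 𝓝[s] y₀, y ∈ Ioo 0 Real.pi) →
      Tendsto (fun y : ℝ => sliceAffine A (fun x => B x / ε) (w (Complex.exp ⟨x, y⟩)))
        (𝓝[s] y₀) (𝓝 (sliceAffine A (fun x => B x / ε) (w t))) := fun x y₀ s t ht hs => by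
    refine ((continuous_sliceAffine hAc.continuous hBεc.continuous).tendsto _).comp ?_
    refine (hw.continuous (t : ℂ) (by simp)).tendsto.comp (tendsto_nhdsWithin_iff.2 ⟨?_, ?_⟩)
    · rw [← ht]
      exact (Complex.continuous_exp.tendsto _).comp (tendsto_mk_left x y₀ s)
    · filter_upwards [hs] with y hy using
        (Complex.exp_mem_upperHalfPlane (s := ⟨x, y⟩) hy).le
  have hmain := length_area_inequality hAc hBεc (α := u) (β := 0)
    (a := fun _ => 0) (b := fun _ => Real.pi) continuous_const continuous_const
    (fun _ _ => Real.pi_pos) (φ := fun s => w (Complex.exp s))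
    (U := {s | s.re ∈ Ioo u 0 ∧ s.im ∈ Ioo 0 Real.pi})
    (Ω := interior (convexHull ℝ (range (thinVertex a b p ε)))) rfl
    (hw.holomorphic.comp Complex.differentiable_exp.differentiableOn
      fun s hs => Complex.exp_mem_upperHalfPlane hs.2) (fun s hs t ht e => ?_)
    (fun s hs => hw.bijective.mapsTo (Complex.exp_mem_upperHalfPlane hs.2)) (c₀ := 1) (c₁ := 0)
    (fun x hx => ?_) (fun x hx => ?_)
  · have key := hmain.trans (hC ε hε)
    have hI : 0 ≤ ∫ x in (α - δ)..(β + δ), 1 / gap a b x :=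
      intervalIntegral.integral_nonneg (by linarith) fun x hx => one_div_nonneg.2 (hgap x hx).le
    have hC0 : C * ε ≤ max C 0 * ε := mul_le_mul_of_nonneg_right (le_max_left _ _) hε.le
    have key' := key.trans (ENNReal.ofReal_le_ofReal (add_le_add_right hC0 _))
    rw [setLIntegral_const, Real.volume_Ioo,
      ← ENNReal.ofReal_mul (div_nonneg (sq_nonneg _) (by linarith [Real.pi_pos])),
      ENNReal.ofReal_le_ofReal_iff (add_nonneg (div_nonneg hI hε.le)
        (mul_nonneg (le_max_right _ _) hε.le))] at key'
    have hpi := Real.pi_pos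
    calc -u = Real.pi * ((0 - 1) ^ 2 / (Real.pi - 0) * (0 - u)) := by
          rw [sub_zero]; field_simp; ring
      _ ≤ Real.pi * ((∫ x in (α - δ)..(β + δ), 1 / gap a b x) / ε + max C 0 * ε) := by gcongr
      _ ≤ Real.pi * (((∫ x in α..β, 1 / gap a b x) + η) / ε + max C 0 * ε) := by gcongr
      _ = _ := by ring
  · have h1 : Complex.exp s = Complex.exp t := hw.bijective.injOn
      (Complex.exp_mem_upperHalfPlane hs.2) (Complex.exp_mem_upperHalfPlane ht.2) e
    exact Complex.exp_inj_of_neg_pi_lt_of_le_pi (by linarith [hs.2.1, Real.pi_pos]) hs.2.2.le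
      (by linarith [ht.2.1, Real.pi_pos]) ht.2.2.le h1
  · have he : Complex.exp ⟨x, 0⟩ = (Real.exp x : ℝ) := by
      rw [Complex.ofReal_exp]; rfl
    rw [← hval0 _ (hw.side_zero _ (hexp x hx)) (hw.map_ofReal_mem_convexHull _)]
    exact hlim x 0 _ _ he (Ioo_mem_nhdsGT Real.pi_pos)
  · have he : Complex.exp ⟨x, Real.pi⟩ = ((-Real.exp x : ℝ) : ℂ) := by
      rw [Complex.mk_eq_add_mul_I, Complex.exp_add, Complex.exp_pi_mul_I, Complex.ofReal_neg,
        Complex.ofReal_exp, mul_neg_one]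
    rw [← hval2 _ (hw.side_two _ (neg_neg_of_pos (Real.exp_pos x)))
      (hw.map_ofReal_mem_convexHull _)]
    exact hlim x Real.pi _ _ he (Ioo_mem_nhdsLT Real.pi_pos)

/-- The modulus of a thin quadrilateral is asymptotically that of its middle region. -/
theorem tendsto_mul_log {ζ : ℝ → ℝ} {w : ℝ → ℂ → ℂ}
    (hw : ∀ ε > 0, IsSchwarzChristoffelMap (thinLine a b ε) (thinVertex a b p ε) (ζ ε) (w ε)) :
    Tendsto (fun ε => ε * Real.log (ζ ε)) (𝓝[>] 0)
      (𝓝 (-(Real.pi * ∫ x in max (p 0) (p 1)..min (p 2) (p 3), 1 / gap a b x))) := by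
  set l := ∫ x in max (p 0) (p 1)..min (p 2) (p 3), 1 / gap a b x with hl
  have hpi := Real.pi_pos
  rw [tendsto_order]
  have hlin : ∀ K : ℝ, Tendsto (fun ε : ℝ => ε * K) (𝓝[>] 0) (𝓝 0) := fun K => by
    have : Tendsto (fun ε : ℝ => ε * K) (𝓝 0) (𝓝 (0 * K)) :=
      (continuous_id.mul continuous_const).tendsto 0
    rw [zero_mul] at this
    exact this.mono_left nhdsWithin_le_nhds
  constructor
  · intro c hc
    set η := (-(Real.pi * l) - c) / (2 * Real.pi) with hη
    have hη0 : 0 < η := div_pos (by linarith) (by positivity)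
    obtain ⟨C, hC⟩ := h.exists_upper_bound hη0
    have hsmall : Tendsto (fun ε : ℝ => ε * (ε * C)) (𝓝[>] 0) (𝓝 0) := by
      have := (hlin 1).mul (hlin C)
      simpa using this
    filter_upwards [self_mem_nhdsWithin, hsmall.eventually_lt_const (mul_pos hpi hη0)] with ε hε hs
    have hε' : (0 : ℝ) < ε := hε
    have hb := mul_le_mul_of_nonneg_left (hC ε hε (ζ ε) (w ε) (hw ε hε)) hε'.le
    have e : ε * (Real.pi * (l + η) / ε + C * ε) = Real.pi * (l + η) + ε * (ε * C) := by
      field_simp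
    rw [← hl, e] at hb
    have e2 : Real.pi * η = (-(Real.pi * l) - c) / 2 := by rw [hη]; field_simp
    nlinarith
  · intro c hc
    obtain ⟨C, hC⟩ := h.exists_lower_bound
    have hlt : 0 < c + Real.pi * l := by linarith
    filter_upwards [self_mem_nhdsWithin, (hlin C).eventually_lt_const hlt] with ε hε hs
    have hε' : (0 : ℝ) < ε := hε
    have hb := mul_le_mul_of_nonneg_left (hC ε hε (ζ ε) (w ε) (hw ε hε)) hε'.le
    have e : ε * (Real.pi * l / ε) = Real.pi * l := by field_simp
    rw [← hl, e] at hb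
    linarith

end IsLeftRightQuadrilateral

/-! ### Gradient trees -/

/-- Along an affine flow the velocity is an exponential function of time. -/
theorem affine_flow_velocity {S : Set ℝ} (hS : Convex ℝ S) {γ : ℝ → ℝ} {m c : ℝ}
    (hγ : ∀ t ∈ S, HasDerivWithinAt γ (m * γ t + c) S t) {s t : ℝ} (hs : s ∈ S) (ht : t ∈ S) :
    (m * γ t + c) * Real.exp (-(m * t)) = (m * γ s + c) * Real.exp (-(m * s)) := by
  have hd : ∀ t ∈ S, HasDerivWithinAt (fun t => (m * γ t + c) * Real.exp (-(m * t))) 0 S t :=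
    fun t ht => by
      have h1 : HasDerivWithinAt (fun t : ℝ => Real.exp (-(m * t)))
          (Real.exp (-(m * t)) * -(m * 1)) S t :=
        (((hasDerivAt_id t).const_mul m).neg.exp).hasDerivWithinAt
      refine ((((hγ t ht).const_mul m).add_const c).mul h1).congr_deriv ?_
      ring
  have := hS.norm_image_sub_le_of_norm_hasDerivWithin_le (C := 0) hd (fun _ _ => by simp) hs ht
  rw [zero_mul, norm_le_zero_iff, sub_eq_zero] at this
  exact this

section Travel

variable {γ : ℝ → ℝ} {m c l : ℝ} (hl : 0 < l)
  (hγ : ∀ t ∈ Icc 0 l, HasDerivWithinAt γ (m * γ t + c) (Icc 0 l) t)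
include hl hγ

theorem affine_flow_velocity_eq {t : ℝ} (ht : t ∈ Icc 0 l) :
    m * γ t + c = (m * γ 0 + c) * Real.exp (m * t) := by
  have := affine_flow_velocity (convex_Icc 0 l) hγ (left_mem_Icc.2 hl.le) ht
  rw [mul_zero, neg_zero, Real.exp_zero, mul_one] at this
  rw [← this, mul_assoc, ← Real.exp_add]
  simp

/-- The travel time of an affine flow is the integral of the reciprocal of its velocity. -/
theorem affine_flow_time (h0 : m * γ 0 + c ≠ 0) : l = ∫ u in γ 0..γ l, 1 / (m * u + c) := by
  have hne : ∀ t ∈ Icc 0 l, m * γ t + c ≠ 0 := fun t ht => by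
    rw [affine_flow_velocity_eq hl hγ ht]
    exact mul_ne_zero h0 (Real.exp_pos _).ne'
  have hc : ContinuousOn γ (Icc 0 l) := fun t ht => (hγ t ht).continuousWithinAt
  have hsub := intervalIntegral.integral_comp_mul_deriv'' (f := γ) (f' := fun t => m * γ t + c)
    (g := fun u => 1 / (m * u + c)) (a := 0) (b := l) (by rwa [uIcc_of_le hl.le])
    (fun t ht => ?_) ?_ ?_
  · rw [← hsub]
    have e : ∫ t in (0 : ℝ)..l, ((fun u => 1 / (m * u + c)) ∘ γ) t * (m * γ t + c) =
        ∫ t in (0 : ℝ)..l, (1 : ℝ) := by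
      refine intervalIntegral.integral_congr fun t ht => ?_
      rw [uIcc_of_le hl.le] at ht
      exact one_div_mul_cancel (hne t ht)
    rw [e]; simp
  · rw [min_eq_left hl.le, max_eq_right hl.le] at ht
    exact ((hγ t ⟨ht.1.le, ht.2.le⟩).hasDerivAt (Icc_mem_nhds ht.1 ht.2)).hasDerivWithinAt
  · rw [uIcc_of_le hl.le]
    exact (continuousOn_const.mul hc).add continuousOn_const
  · rw [uIcc_of_le hl.le]
    refine continuousOn_const.div (by fun_prop) ?_
    rintro _ ⟨t, ht, rfl⟩
    exact hne t ht

theorem affine_flow_lt (h0 : 0 < m * γ 0 + c) : γ 0 < γ l := by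
  have hc : ContinuousOn γ (Icc 0 l) := fun t ht => (hγ t ht).continuousWithinAt
  obtain ⟨ξ, hξ, e⟩ := exists_hasDerivAt_eq_slope γ (fun t => m * γ t + c) hl hc
    fun t ht => (hγ t ⟨ht.1.le, ht.2.le⟩).hasDerivAt (Icc_mem_nhds ht.1 ht.2)
  simp only [affine_flow_velocity_eq hl hγ ⟨hξ.1.le, hξ.2.le⟩, sub_zero] at e
  have h1 : 0 < (γ l - γ 0) / l := e ▸ mul_pos h0 (Real.exp_pos _)
  have h2 := (div_pos_iff_of_pos_right hl).1 h1
  linarith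

end Travel

theorem affine_flow_gt {γ : ℝ → ℝ} {m c l : ℝ} (hl : 0 < l)
    (hγ : ∀ t ∈ Icc 0 l, HasDerivWithinAt γ (m * γ t + c) (Icc 0 l) t)
    (h0 : m * γ 0 + c < 0) : γ l < γ 0 := by
  have := affine_flow_lt (γ := fun t => -γ t) (m := m) (c := -c) hl
    (fun t ht => (hγ t ht).neg.congr_deriv (by ring)) (by linarith)
  linarith

/-- An affine flow with positive velocity at two points moves the left one to the right one. -/
theorem exists_affine_flow {m c α β : ℝ} (hαβ : α < β) (hα : 0 < m * α + c) (hβ : 0 < m * β + c) :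
    ∃ γ : ℝ → ℝ, ∃ l > 0, (∀ t, HasDerivAt γ (m * γ t + c) t) ∧ γ 0 = α ∧ γ l = β := by
  rcases eq_or_ne m 0 with rfl | hm
  · rw [zero_mul, zero_add] at hα
    refine ⟨fun t => α + c * t, (β - α) / c, div_pos (by linarith) hα, fun t => ?_, by simp, ?_⟩
    · exact (((hasDerivAt_id t).const_mul c).const_add α).congr_deriv (by simp)
    · field_simp; ring
  · refine ⟨fun t => ((m * α + c) * Real.exp (m * t) - c) / m,
      Real.log ((m * β + c) / (m * α + c)) / m, ?_, fun t => ?_, ?_, ?_⟩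
    · rcases hm.lt_or_gt with hneg | hpos
      · refine div_pos_of_neg_of_neg (Real.log_neg (div_pos hβ hα) ?_) hneg
        rw [div_lt_one hα]; nlinarith
      · refine div_pos (Real.log_pos ?_) hpos
        rw [one_lt_div hα]; nlinarith
    · have h1 : HasDerivAt (fun t : ℝ => Real.exp (m * t)) (Real.exp (m * t) * (m * 1)) t :=
        ((hasDerivAt_id t).const_mul m).exp
      refine (((h1.const_mul (m * α + c)).sub_const c).div_const m).congr_deriv ?_
      field_simp
      ring
    · simp only [mul_zero, Real.exp_zero]; field_simp; ring
    · simp only [mul_div_cancel₀ _ hm]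
      rw [Real.exp_log (div_pos hβ hα)]
      field_simp
      ring

/-- As `t → -∞`, every non-constant solution of `γ' = -A (γ - q)` with `A > 0` is driven away
from `q`. -/
theorem affine_flow_eq_of_tendsto {γ : ℝ → ℝ} {A q : ℝ} (hA : 0 < A)
    (hγ : ∀ t ∈ Iic (0 : ℝ), HasDerivWithinAt γ (-(A * (γ t - q))) (Iic 0) t)
    (hlim : Tendsto γ atBot (𝓝 q)) : γ 0 = q := by
  have hγ' : ∀ t ∈ Iic (0 : ℝ), HasDerivWithinAt γ (-A * γ t + A * q) (Iic 0) t := fun t ht =>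
    (hγ t ht).congr_deriv (by ring)
  have hconst : ∀ t ∈ Iic (0 : ℝ), (-A * γ t + A * q) * Real.exp (A * t) = -A * γ 0 + A * q :=
    fun t ht => by
      have := affine_flow_velocity (convex_Iic 0) hγ' (mem_Iic.2 le_rfl) ht
      simpa using this
  have hexp : Tendsto (fun t : ℝ => Real.exp (A * t)) atBot (𝓝 0) :=
    Real.tendsto_exp_atBot.comp (tendsto_id.const_mul_atBot hA)
  have h0 : Tendsto (fun t => (-A * γ t + A * q) * Real.exp (A * t)) atBot
      (𝓝 ((-A * q + A * q) * 0)) := ((hlim.const_mul _).add_const _).mul hexp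
  have h1 : Tendsto (fun t => (-A * γ t + A * q) * Real.exp (A * t)) atBot
      (𝓝 (-A * γ 0 + A * q)) := by
    refine tendsto_const_nhds.congr' ?_
    filter_upwards [Iic_mem_atBot (0 : ℝ)] with t ht using (hconst t ht).symm
  have h2 := tendsto_nhds_unique h1 h0
  have h3 : A * (q - γ 0) = 0 := by linarith
  linarith [(mul_eq_zero.1 h3).resolve_left hA.ne']

/-- If `A < 0`, a solution of `γ' = -A (γ - q)` emanating from `q` can end at any point `r`. -/
theorem exists_affine_flow_tendsto {A q r : ℝ} (h : A < 0 ∨ r = q) :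
    ∃ γ : ℝ → ℝ, (∀ t, HasDerivAt γ (-(A * (γ t - q))) t) ∧ Tendsto γ atBot (𝓝 q) ∧ γ 0 = r := by
  rcases h with hA | rfl
  · refine ⟨fun t => q + (r - q) * Real.exp (-A * t), fun t => ?_, ?_, by simp⟩
    · have h1 : HasDerivAt (fun t : ℝ => Real.exp (-A * t)) (Real.exp (-A * t) * (-A * 1)) t :=
        ((hasDerivAt_id t).const_mul (-A)).exp
      exact ((h1.const_mul (r - q)).const_add q).congr_deriv (by ring)
    · have hexp : Tendsto (fun t : ℝ => Real.exp (-A * t)) atBot (𝓝 0) :=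
        Real.tendsto_exp_atBot.comp (tendsto_id.const_mul_atBot (by linarith))
      simpa using (hexp.const_mul (r - q)).const_add q
  · exact ⟨fun _ => r, fun t => (hasDerivAt_const t r).congr_deriv (by ring), tendsto_const_nhds,
      rfl⟩

namespace IsLeftRightQuadrilateral

variable {a b p : Fin 4 → ℝ} (h : IsLeftRightQuadrilateral a b p)
include h

theorem integral_inv_gap_pos :
    0 < ∫ x in max (p 0) (p 1)..min (p 2) (p 3), 1 / gap a b x := by
  refine intervalIntegral.intervalIntegral_pos_of_pos_on ?_ (fun x hx => ?_) h.max_lt_min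
  · refine ContinuousOn.intervalIntegrable ?_
    rw [uIcc_of_le h.max_lt_min.le]
    exact continuousOn_const.div (continuous_gap a b).continuousOn
      fun x hx => (h.gap_pos_of_mem_Icc hx).ne'
  · exact one_div_pos.2 (h.gap_pos_of_mem_Icc ⟨hx.1.le, hx.2.le⟩)

/-- An exterior edge at a vertex where `f (i + 1) - f i` is convex is constant, whereas it can end
anywhere if `f (i + 1) - f i` is concave. As exactly one of the vertices `0, 1` and one of the
vertices `2, 3` is of the first kind, the end points of the interior edge are determined. It cannot
separate the vertices `1, 2` from `3, 0`: either both determined points would be its same end, or it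
would have to flow backwards. -/
theorem isInteriorEdgeLength {f : Fin 4 → ℝ → ℝ}
    (hf : ∀ i t, HasDerivAt (f i) (a i * t + b i) t) :
    IsInteriorEdgeLength f p (∫ x in max (p 0) (p 1)..min (p 2) (p 3), 1 / gap a b x) := by
  set α := max (p 0) (p 1) with hα
  set β := min (p 2) (p 3) with hβ
  have hαβ : α < β := h.max_lt_min
  have hder : ∀ i j t, deriv (fun q => f j q - f i q) t = (a j * t + b j) - (a i * t + b i) :=
    fun i j t => ((hf j t).sub (hf i t)).deriv
  have hder' : ∀ i t, -deriv (fun q => f (i + 1) q - f i q) t =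
      -((a (i + 1) - a i) * (t - p i)) := fun i t => by
    rw [hder]; linear_combination -h.meet i
  have hgapder : ∀ t, -deriv (fun q => f 2 q - f 0 q) t = (a 0 - a 2) * t + (b 0 - b 2) :=
    fun t => by rw [hder]; ring
  have hder13 : ∀ t, -deriv (fun q => f 3 q - f 1 q) t = (a 1 - a 3) * t + (b 1 - b 3) :=
    fun t => by rw [hder]; ring
  have hleft : (a (0 + 1) - a 0 < 0 ∧ 0 < a (1 + 1) - a 1 ∧ α = p 1) ∨
      (0 < a (0 + 1) - a 0 ∧ a (1 + 1) - a 1 < 0 ∧ α = p 0) := by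
    rcases h.left_cases with ⟨h1, h2, h3⟩ | ⟨h1, h2, h3⟩
    · exact .inl ⟨sub_neg.2 h2, sub_pos.2 h3, max_eq_right h1.le⟩
    · exact .inr ⟨sub_pos.2 h2, sub_neg.2 h3, max_eq_left h1.le⟩
  have hright : (0 < a (2 + 1) - a 2 ∧ a (3 + 1) - a 3 < 0 ∧ β = p 2) ∨
      (a (2 + 1) - a 2 < 0 ∧ 0 < a (3 + 1) - a 3 ∧ β = p 3) := by
    rcases h.right_cases with ⟨h1, h2, h3⟩ | ⟨h1, h2, h3⟩
    · exact .inl ⟨sub_pos.2 h2, sub_neg.2 h3, min_eq_left h1.le⟩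
    · exact .inr ⟨sub_neg.2 h2, sub_pos.2 h3, min_eq_right h1.le⟩
  constructor
  · obtain ⟨γ, l, hl, hγ, hγ0, hγl⟩ := exists_affine_flow (m := a 0 - a 2) (c := b 0 - b 2) hαβ
      h.gap_max_pos h.gap_min_pos
    have hq : ∀ i, (a (i + 1) - a i < 0 ∨ (![α, α, β, β] : Fin 4 → ℝ) i = p i) := fun i => by
      fin_cases i
      · rcases hleft with ⟨h1, h2, h3⟩ | ⟨h1, h2, h3⟩
        exacts [.inl h1, .inr h3]
      · rcases hleft with ⟨h1, h2, h3⟩ | ⟨h1, h2, h3⟩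
        exacts [.inr h3, .inl h2]
      · rcases hright with ⟨h1, h2, h3⟩ | ⟨h1, h2, h3⟩
        exacts [.inr h3, .inl h1]
      · rcases hright with ⟨h1, h2, h3⟩ | ⟨h1, h2, h3⟩
        exacts [.inl h2, .inr h3]
    choose I hI hIlim hI0 using fun i => exists_affine_flow_tendsto (hq i)
    refine ⟨.edge02 l hl, I, γ, fun i => ⟨fun t _ => ?_, hIlim i⟩, fun t _ => ?_, ?_, ?_, ?_, ?_⟩
    · exact ((hI i t).congr_deriv (hder' i _).symm).hasDerivWithinAt
    · exact ((hγ t).congr_deriv (hgapder _).symm).hasDerivWithinAt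
    · rw [hI0, hγ0]; rfl
    · rw [hI0, hγ0]; rfl
    · rw [hI0, hγl]; rfl
    · rw [hI0, hγl]; rfl
  · intro T I J hT
    obtain ⟨hext, hint⟩ := hT
    have hforced : ∀ i, 0 < a (i + 1) - a i → I i 0 = p i := fun i hi =>
      affine_flow_eq_of_tendsto hi
        (fun t ht => ((hext i).1 t ht).congr_deriv (hder' i _)) (hext i).2
    cases T with
    | star =>
      exfalso
      have hi : ∀ i j, I i 0 = I j 0 := hint
      rcases hleft with ⟨-, h1, h2⟩ | ⟨h1, -, h2⟩ <;>
      rcases hright with ⟨h3, -, h4⟩ | ⟨-, h3, h4⟩ <;>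
      exact hαβ.ne (by rw [h2, h4, ← hforced _ h1, ← hforced _ h3, hi])
    | edge02 l hl =>
      obtain ⟨hJ, e0, e1, e2, e3⟩ := hint
      have hJ' : ∀ t ∈ Icc 0 l,
          HasDerivWithinAt J ((a 0 - a 2) * J t + (b 0 - b 2)) (Icc 0 l) t := fun t ht =>
        (hJ t ht).congr_deriv (hgapder _)
      have hJ0 : J 0 = α := by
        rcases hleft with ⟨-, h1, h2⟩ | ⟨h1, -, h2⟩
        · rw [h2, ← hforced _ h1, e1]
        · rw [h2, ← hforced _ h1, e0]
      have hJl : J l = β := by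
        rcases hright with ⟨h1, -, h2⟩ | ⟨-, h1, h2⟩
        · rw [h2, ← hforced _ h1, e2]
        · rw [h2, ← hforced _ h1, e3]
      have htime := affine_flow_time hl hJ' (by rw [hJ0]; exact h.gap_max_pos.ne')
      rw [hJ0, hJl] at htime
      exact congrArg (fun r => ({r} : Set ℝ)) htime
    | edge13 l hl =>
      exfalso
      obtain ⟨hJ, e1, e2, e3, e0⟩ := hint
      have hJ' : ∀ t ∈ Icc 0 l,
          HasDerivWithinAt J ((a 1 - a 3) * J t + (b 1 - b 3)) (Icc 0 l) t := fun t ht =>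
        (hJ t ht).congr_deriv (hder13 _)
      have m1 := h.meet_one
      have m2 := h.meet_two
      have h12 := sub_pos.2 h.lt_one_two
      rcases hleft with ⟨-, h1, h2⟩ | ⟨h1, h1', h2⟩
      · have hJ0 : J 0 = p 1 := by rw [← hforced _ h1, e1]
        rcases hright with ⟨h3, -, h4⟩ | ⟨h3', h3, h4⟩
        · exact hαβ.ne (by rw [h2, h4, ← hforced _ h3, e2, hJ0])
        · have hJl : J l = p 3 := by rw [← hforced _ h3, e3]
          have e : (2 + 1 : Fin 4) = 3 := rfl
          rw [e] at h3'
          have := affine_flow_gt hl hJ' (by rw [hJ0]; nlinarith)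
          linarith [h.lt_one_three]
      · have hJl : J l = p 0 := by rw [← hforced _ h1, e0]
        rcases hright with ⟨h3, -, h4⟩ | ⟨-, h3, h4⟩
        · have hJ0 : J 0 = p 2 := by rw [← hforced _ h3, e2]
          have e : (1 + 1 : Fin 4) = 2 := rfl
          rw [e] at h1'
          have := affine_flow_lt hl hJ' (by rw [hJ0]; nlinarith)
          linarith [h.lt_zero_two]
        · exact hαβ.ne (by rw [h2, h4, ← hforced _ h3, e3, hJl])

end IsLeftRightQuadrilateral

/-! ### Symmetries -/

/-- A transformation of the data that carries gradient trees over in both directions and keeps the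
lengths of interior edges also carries over the length of the interior edge. -/
theorem IsInteriorEdgeLength.of_transform {f f' : Fin 4 → ℝ → ℝ} {p p' : Fin 4 → ℝ} {l : ℝ}
    (hto : ∀ T I J, IsGradientTree f p T I J →
      ∃ T' I' J', IsGradientTree f' p' T' I' J' ∧ T'.interiorLengths = T.interiorLengths)
    (hfrom : ∀ T I J, IsGradientTree f' p' T I J →
      ∃ T' I' J', IsGradientTree f p T' I' J' ∧ T'.interiorLengths = T.interiorLengths)
    (h : IsInteriorEdgeLength f' p' l) : IsInteriorEdgeLength f p l := by
  obtain ⟨⟨T, I, J, hT⟩, huniq⟩ := h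
  obtain ⟨T', I', J', hT', -⟩ := hfrom T I J hT
  refine ⟨⟨T', I', J', hT'⟩, fun T I J hT => ?_⟩
  obtain ⟨T', I', J', hT', e⟩ := hto T I J hT
  rw [← e]
  exact huniq T' I' J' hT'

theorem IsGradientTree.shift {f : Fin 4 → ℝ → ℝ} {p : Fin 4 → ℝ} {T : MetricRibbonTree}
    {I : Fin 4 → ℝ → ℝ} {J : ℝ → ℝ} (h : IsGradientTree f p T I J) :
    ∃ T' I' J', IsGradientTree (fun i => f (i + 1)) (fun i => p (i + 1)) T' I' J' ∧
      T'.interiorLengths = T.interiorLengths := by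
  obtain ⟨hext, hint⟩ := h
  cases T with
  | star => exact ⟨.star, fun i => I (i + 1), J, ⟨fun i => hext (i + 1), fun i j => hint _ _⟩, rfl⟩
  | edge02 l hl =>
    obtain ⟨hJ, e0, e1, e2, e3⟩ := hint
    -- the interior edge is traversed in the opposite direction
    refine ⟨.edge13 l hl, fun i => I (i + 1), fun t => J (l - t),
      ⟨fun i => hext (i + 1), fun t ht => ?_, ?_, ?_, ?_, ?_⟩, rfl⟩
    · have hmem : l - t ∈ Icc 0 l := ⟨by linarith [ht.2], by linarith [ht.1]⟩
      have h1 : HasDerivWithinAt (fun t : ℝ => l - t) (-1) (Icc 0 l) t :=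
        ((hasDerivAt_id t).const_sub l).hasDerivWithinAt
      refine ((hJ _ hmem).scomp t h1 fun s hs => ⟨by linarith [hs.2], by linarith [hs.1]⟩).congr_deriv
        ?_
      have e : (fun q => f (3 + 1) q - f (1 + 1) q) = fun q => -(f 2 q - f 0 q) := by
        funext q; rw [neg_sub]; rfl
      rw [e, deriv.fun_neg]
      simp
    · simpa using e2
    · simpa using e3
    · simpa using e0
    · simpa using e1
  | edge13 l hl =>
    obtain ⟨hJ, e1, e2, e3, e0⟩ := hint
    exact ⟨.edge02 l hl, fun i => I (i + 1), J,
      ⟨fun i => hext (i + 1), hJ, e1, e2, e3, e0⟩, rfl⟩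

theorem IsGradientCurve.reflect {g : ℝ → ℝ} {s : Set ℝ} {γ : ℝ → ℝ} (h : IsGradientCurve g s γ) :
    IsGradientCurve (fun q => g (-q)) s fun t => -γ t := fun t ht => by
  refine (h t ht).neg.congr_deriv ?_
  rw [deriv_comp_neg]
  simp only [neg_neg]

theorem IsGradientTree.reflect {f : Fin 4 → ℝ → ℝ} {p : Fin 4 → ℝ} {T : MetricRibbonTree}
    {I : Fin 4 → ℝ → ℝ} {J : ℝ → ℝ} (h : IsGradientTree f p T I J) :
    IsGradientTree (fun i q => f i (-q)) (fun i => -p i) T (fun i t => -I i t) fun t => -J t := by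
  obtain ⟨hext, hint⟩ := h
  refine ⟨fun i => ⟨(hext i).1.reflect, (hext i).2.neg⟩, ?_⟩
  cases T with
  | star => exact fun i j => congrArg Neg.neg (hint i j)
  | edge02 l hl =>
    obtain ⟨hJ, e0, e1, e2, e3⟩ := hint
    exact ⟨hJ.reflect, congrArg Neg.neg e0, congrArg Neg.neg e1, congrArg Neg.neg e2,
      congrArg Neg.neg e3⟩
  | edge13 l hl =>
    obtain ⟨hJ, e0, e1, e2, e3⟩ := hint
    exact ⟨hJ.reflect, congrArg Neg.neg e0, congrArg Neg.neg e1, congrArg Neg.neg e2,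
      congrArg Neg.neg e3⟩

theorem IsInteriorEdgeLength.of_shift {f : Fin 4 → ℝ → ℝ} {p : Fin 4 → ℝ} {l : ℝ}
    (h : IsInteriorEdgeLength (fun i => f (i + 1)) (fun i => p (i + 1)) l) :
    IsInteriorEdgeLength f p l := by
  refine h.of_transform (fun T I J hT => hT.shift) fun T I J hT => ?_
  obtain ⟨T₁, I₁, J₁, hT₁, e₁⟩ := hT.shift
  obtain ⟨T₂, I₂, J₂, hT₂, e₂⟩ := hT₁.shift
  obtain ⟨T₃, I₃, J₃, hT₃, e₃⟩ := hT₂.shift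
  have e : ∀ i : Fin 4, i + 1 + 1 + 1 + 1 = i := by decide
  simp only [e] at hT₃
  exact ⟨T₃, I₃, J₃, hT₃, by rw [e₃, e₂, e₁]⟩

theorem IsInteriorEdgeLength.of_reflect {f : Fin 4 → ℝ → ℝ} {p : Fin 4 → ℝ} {l : ℝ}
    (h : IsInteriorEdgeLength (fun i q => f i (-q)) (fun i => -p i) l) :
    IsInteriorEdgeLength f p l := by
  refine h.of_transform (fun T I J hT => ⟨T, _, _, hT.reflect, rfl⟩) fun T I J hT => ?_
  have := hT.reflect
  simp only [neg_neg] at this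
  exact ⟨T, _, _, this, rfl⟩

/-- Rotation of the quadrilateral by `π`. -/
theorem IsSchwarzChristoffelMap.neg {L : Fin 4 → Set ℂ} {x : Fin 4 → ℂ} {ζ : ℝ} {w : ℂ → ℂ}
    (hw : IsSchwarzChristoffelMap L x ζ w) :
    IsSchwarzChristoffelMap (fun i => {z | -z ∈ L i}) (fun i => -x i) ζ fun z => -w z := by
  have hrange : interior (convexHull ℝ (range fun i => -x i)) =
      Neg.neg '' interior (convexHull ℝ (range x)) := by
    have e1 : (range fun i => -x i) = (LinearEquiv.neg ℝ : ℂ ≃ₗ[ℝ] ℂ).toLinearMap '' range x := by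
      rw [← range_comp]; rfl
    rw [e1, ← LinearMap.image_convexHull]
    exact ((Homeomorph.neg ℂ).image_interior _).symm
  exact
    { zeta_mem := hw.zeta_mem
      holomorphic := hw.holomorphic.neg
      bijective := by
        rw [hrange]
        exact (neg_injective.injOn.bijOn_image (s := interior (convexHull ℝ (range x)))).comp
          hw.bijective
      continuous := hw.continuous.neg
      map_one := by rw [hw.map_one]
      map_infty := hw.map_infty.neg
      map_zero := by rw [hw.map_zero]
      map_zeta := by rw [hw.map_zeta]
      side_zero := fun t ht => by simpa using hw.side_zero t ht
      side_one := fun t ht => by simpa using hw.side_one t ht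
      side_two := fun t ht => by simpa using hw.side_two t ht
      side_three := fun t ht => by simpa using hw.side_three t ht }

theorem im_const_div {ζ : ℝ} (z : ℂ) : ((ζ : ℂ) / (1 - z)).im = ζ * z.im / Complex.normSq (1 - z) := by
  rw [Complex.div_im]
  simp only [Complex.ofReal_im, Complex.sub_re, Complex.one_re, zero_mul, zero_div,
    Complex.ofReal_re, Complex.sub_im, Complex.one_im]
  ring

/-- Renumbering the vertices cyclically: the Möbius transformation `z ↦ ζ / (1 - z)` of the upper
half plane maps the marked points `1, ∞, 0, 1 - ζ` to `∞, 0, ζ, 1`. At `z = 1` the division by zero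
does not give the value at `∞`, so this value has to be prescribed. -/
theorem IsSchwarzChristoffelMap.shift {L : Fin 4 → Set ℂ} {x : Fin 4 → ℂ} {ζ : ℝ} {w : ℂ → ℂ}
    (hw : IsSchwarzChristoffelMap L x ζ w) :
    IsSchwarzChristoffelMap (fun i => L (i + 1)) (fun i => x (i + 1)) (1 - ζ)
      (Function.update (fun z => w (ζ / (1 - z))) 1 (x 1)) := by
  have hζ := hw.zeta_mem
  have hζ0 : (ζ : ℂ) ≠ 0 := Complex.ofReal_ne_zero.2 hζ.1.ne'
  set v : ℂ → ℂ := Function.update (fun z => w (ζ / (1 - z))) 1 (x 1) with hv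
  have hv_ne : ∀ z, z ≠ 1 → v z = w (ζ / (1 - z)) := fun z hz => Function.update_of_ne hz _ _
  have hne : ∀ z : ℂ, 0 < z.im → z ≠ 1 := fun z hz e => by rw [e] at hz; simp at hz
  have hvreal : ∀ t : ℝ, t ≠ 1 → v t = w ((ζ / (1 - t) : ℝ) : ℂ) := fun t ht => by
    rw [hv_ne _ (by exact_mod_cast ht)]; push_cast; rfl
  have hmaps : ∀ z : ℂ, 0 < z.im → 0 < ((ζ : ℂ) / (1 - z)).im := fun z hz => by
    rw [im_const_div]
    exact div_pos (mul_pos hζ.1 hz) (Complex.normSq_pos.2 (sub_ne_zero.2 (hne z hz).symm))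
  have hmaps' : ∀ z : ℂ, 0 ≤ z.im → 0 ≤ ((ζ : ℂ) / (1 - z)).im := fun z hz => by
    rw [im_const_div]
    exact div_nonneg (mul_nonneg hζ.1.le hz) (Complex.normSq_nonneg _)
  have hbij : BijOn (fun z : ℂ => (ζ : ℂ) / (1 - z)) {z | 0 < z.im} {z | 0 < z.im} := by
    refine ⟨hmaps, fun z hz z' hz' e => ?_, fun u hu => ?_⟩
    · have h1 : (1 - z) ≠ 0 := sub_ne_zero.2 (hne z hz).symm
      have h2 : (1 - z') ≠ 0 := sub_ne_zero.2 (hne z' hz').symm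
      have e' : (ζ : ℂ) / (1 - z) = ζ / (1 - z') := e
      rw [div_eq_div_iff h1 h2] at e'
      have := mul_left_cancel₀ hζ0 e'
      linear_combination this
    · have hu0 : u ≠ 0 := fun e => by rw [e] at hu; simp at hu
      refine ⟨1 - ζ / u, ?_, ?_⟩
      · have hu' : 0 < u.im := hu
        have : (1 - (ζ : ℂ) / u).im = ζ * u.im / Complex.normSq u := by
          rw [Complex.sub_im, Complex.div_im]; simp
        rw [mem_ofPred_eq, this]
        exact div_pos (mul_pos hζ.1 hu') (Complex.normSq_pos.2 hu0)
      · simp only [sub_sub_cancel]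
        field_simp
  have hrange : (range fun i => x (i + 1)) = range x :=
    (Equiv.addRight (1 : Fin 4)).surjective.range_comp x
  have hcob : Tendsto (fun z : ℂ => (ζ : ℂ) / (1 - z)) (𝓝[≠] 1) (Bornology.cobounded ℂ) := by
    have h1 : Tendsto (fun z : ℂ => (1 - z)) (𝓝[≠] 1) (𝓝[≠] 0) := by
      refine tendsto_nhdsWithin_iff.2 ⟨?_, ?_⟩
      · have : Tendsto (fun z : ℂ => 1 - z) (𝓝 1) (𝓝 (1 - 1)) :=
          (continuous_const.sub continuous_id).tendsto 1
        rw [sub_self] at this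
        exact this.mono_left nhdsWithin_le_nhds
      · filter_upwards [self_mem_nhdsWithin] with z hz using sub_ne_zero.2 (Ne.symm hz)
    have h2 := (tendsto_inv₀_nhdsNE_zero (α := ℂ)).comp h1
    simp only [div_eq_mul_inv]
    exact (tendsto_mul_left_cobounded hζ0).comp h2
  refine
    { zeta_mem := ⟨by linarith [hζ.2], by linarith [hζ.1]⟩
      holomorphic := ?_
      bijective := ?_
      continuous := ?_
      map_one := ?_
      map_infty := ?_
      map_zero := ?_
      map_zeta := ?_
      side_zero := ?_
      side_one := ?_
      side_two := ?_
      side_three := ?_ }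
  · have : DifferentiableOn ℂ (fun z => w (ζ / (1 - z))) {z | 0 < z.im} :=
      hw.holomorphic.comp (fun z hz => ((differentiableAt_const _).div
        ((differentiableAt_const _).sub differentiableAt_id)
        (sub_ne_zero.2 (hne z hz).symm)).differentiableWithinAt) hmaps
    exact this.congr fun z hz => hv_ne z (hne z hz)
  · rw [hrange]
    exact (hw.bijective.comp hbij).congr fun z hz => (hv_ne z (hne z hz)).symm
  · intro z hz
    by_cases h1 : z = 1
    · subst h1
      have hmain : Tendsto v (𝓝[{z | 0 ≤ z.im} \ {1}] 1) (𝓝 (x 1)) := by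
        have h2 : Tendsto (fun z : ℂ => (ζ : ℂ) / (1 - z)) (𝓝[{z | 0 ≤ z.im} \ {1}] 1)
            (Bornology.cobounded ℂ ⊓ 𝓟 {z | 0 ≤ z.im}) := by
          refine tendsto_inf.2 ⟨hcob.mono_left (nhdsWithin_mono _ fun z hz => hz.2), ?_⟩
          refine tendsto_principal.2 ?_
          filter_upwards [self_mem_nhdsWithin] with z hz using hmaps' z hz.1
        refine (hw.map_infty.comp h2).congr' ?_
        filter_upwards [self_mem_nhdsWithin] with z hz using (hv_ne z hz.2).symm
      rw [← continuousWithinAt_sdiff_self, ContinuousWithinAt]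
      rwa [show v 1 = x 1 from Function.update_self _ _ _]
    · have hcont : ContinuousWithinAt (fun z => w (ζ / (1 - z))) {z | 0 ≤ z.im} z :=
        ContinuousWithinAt.comp (t := {z : ℂ | 0 ≤ z.im}) (hw.continuous _ (hmaps' z hz))
          (ContinuousAt.continuousWithinAt (continuousAt_const.div
            (continuousAt_const.sub continuousAt_id) (sub_ne_zero.2 (Ne.symm h1)))) hmaps'
      refine hcont.congr_of_eventuallyEq ?_ (hv_ne z h1)
      filter_upwards [nhdsWithin_le_nhds (isOpen_ne.mem_nhds h1)] with u hu using hv_ne u hu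
  · exact Function.update_self _ _ _
  · have h1 : Tendsto (fun z : ℂ => (ζ : ℂ) / (1 - z)) (Bornology.cobounded ℂ) (𝓝 0) := by
      have hs : Tendsto (fun z : ℂ => 1 - z) (Bornology.cobounded ℂ) (Bornology.cobounded ℂ) := by
        rw [← tendsto_norm_atTop_iff_cobounded]
        refine tendsto_atTop_mono (f := fun z : ℂ => ‖z‖ - 1) (fun z => ?_) ?_
        · have := norm_sub_norm_le z 1
          rw [norm_sub_rev] at this
          simpa using this
        · exact tendsto_atTop_add_const_right _ _ tendsto_norm_cobounded_atTop
      have h2 := (tendsto_inv₀_cobounded (α := ℂ)).comp hs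
      have h3 := h2.const_mul (ζ : ℂ)
      rw [mul_zero] at h3
      simpa only [div_eq_mul_inv, Function.comp_apply] using h3
    have h2 : Tendsto (fun z : ℂ => (ζ : ℂ) / (1 - z))
        (Bornology.cobounded ℂ ⊓ 𝓟 {z | 0 ≤ z.im}) (𝓝[{z | 0 ≤ z.im}] 0) := by
      refine tendsto_nhdsWithin_iff.2 ⟨h1.mono_left inf_le_left, ?_⟩
      filter_upwards [mem_inf_of_right (mem_principal_self _)] with z hz using hmaps' z hz
    have h3 : Tendsto w (𝓝[{z | 0 ≤ z.im}] 0) (𝓝 (x 2)) := by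
      rw [← hw.map_zero]
      exact hw.continuous 0 (by simp)
    refine (h3.comp h2).congr' ?_
    have : ∀ᶠ z : ℂ in Bornology.cobounded ℂ, z ≠ 1 :=
      Bornology.isBounded_def.1 (Bornology.isBounded_singleton (x := (1 : ℂ)))
    filter_upwards [mem_inf_of_left this] with z hz using (hv_ne z hz).symm
  · have := hvreal 0 (by norm_num)
    rw [Complex.ofReal_zero] at this
    rw [this, sub_zero, div_one]
    exact hw.map_zeta
  · have := hvreal (1 - ζ) (by linarith [hζ.1])
    rw [this, sub_sub_cancel, div_self hζ.1.ne', Complex.ofReal_one]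
    exact hw.map_one
  · intro t ht
    rw [hvreal t ht.2.ne]
    refine hw.side_one _ ?_
    rw [mem_Ioi, one_lt_div (by linarith [ht.2])]
    linarith [ht.1]
  · intro t ht
    have ht1 : 1 < t := ht
    rw [hvreal t ht1.ne']
    exact hw.side_two _ (div_neg_of_pos_of_neg hζ.1 (by linarith))
  · intro t ht
    have ht0 : t < 0 := ht
    rw [hvreal t (by linarith)]
    refine hw.side_three _ ⟨div_pos hζ.1 (by linarith), ?_⟩
    exact div_lt_self hζ.1 (by linarith)
  · intro t ht
    rw [hvreal t (by linarith [ht.2, hζ.1])]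
    have h1 : 0 < 1 - t := by linarith [ht.2, hζ.1]
    refine hw.side_zero _ ⟨?_, ?_⟩
    · rw [lt_div_iff₀ h1]; nlinarith [ht.1, hζ.1]
    · rw [div_lt_one h1]; linarith [ht.2]

/-! ### Asymptotics of the modulus -/

/-- The data of the theorem: Schwarz–Christoffel maps `w ε` onto the quadrilaterals bounded by the
Lagrangians of `ε f i`, for all `ε > 0`. -/
structure IsLagrangianQuadrilateral (f : Fin 4 → ℝ → ℝ) (p : Fin 4 → ℝ) (x : ℝ → Fin 4 → ℂ)
    (w : ℝ → ℂ → ℂ) (ζ : ℝ → ℝ) : Prop where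
  affine : ∀ i, HasAffineDerivative (f i)
  critical : ∀ i, deriv (fun q => f (i + 1) q - f i q) (p i) = 0
  vertex : ∀ ε : ℝ, 0 < ε → ∀ i, x ε i ∈ lagrangian (f i) ε ∩ lagrangian (f (i + 1)) ε
  convex : ∀ ε : ℝ, 0 < ε → IsConvexQuadrilateralCCW (x ε)
  conformal : ∀ ε : ℝ, 0 < ε →
    IsSchwarzChristoffelMap (fun i => lagrangian (f i) ε) (x ε) (ζ ε) (w ε)

namespace IsLagrangianQuadrilateral

variable {f : Fin 4 → ℝ → ℝ} {p : Fin 4 → ℝ} {x : ℝ → Fin 4 → ℂ} {w : ℝ → ℂ → ℂ} {ζ : ℝ → ℝ}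

theorem reflect (h : IsLagrangianQuadrilateral f p x w ζ) :
    IsLagrangianQuadrilateral (fun i q => f i (-q)) (fun i => -p i) (fun ε i => -x ε i)
      (fun ε z => -w ε z) ζ := by
  have hL : ∀ i ε, lagrangian (fun q => f i (-q)) ε = {z | -z ∈ lagrangian (f i) ε} := fun i ε => by
    ext z
    simp only [lagrangian, mem_ofPred_eq, Complex.neg_im, Complex.neg_re, deriv_comp_neg, mul_neg]
    constructor <;> intro e <;> linarith
  refine ⟨fun i => ?_, fun i => ?_, fun ε hε i => ?_, fun ε hε i => ?_, fun ε hε => ?_⟩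
  · obtain ⟨a, b, hab⟩ := h.affine i
    refine ⟨a, -b, fun t => ?_⟩
    exact ((hab (-t)).comp t (hasDerivAt_neg t)).congr_deriv (by ring)
  · have := deriv_comp_neg (fun q => f (i + 1) q - f i q) (-p i)
    rw [this, neg_neg, h.critical i, neg_zero]
  · rw [hL, hL]
    simpa using h.vertex ε hε i
  · have := h.convex ε hε i
    simp only [Complex.sub_re, Complex.sub_im, Complex.neg_re, Complex.neg_im] at this ⊢
    linarith
  · simp only [hL]
    exact (h.conformal ε hε).neg

theorem shift (h : IsLagrangianQuadrilateral f p x w ζ) :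
    IsLagrangianQuadrilateral (fun i => f (i + 1)) (fun i => p (i + 1)) (fun ε i => x ε (i + 1))
      (fun ε => Function.update (fun z => w ε (ζ ε / (1 - z))) 1 (x ε 1)) fun ε => 1 - ζ ε where
  affine i := h.affine (i + 1)
  critical i := h.critical (i + 1)
  vertex ε hε i := h.vertex ε hε (i + 1)
  convex ε hε i := by
    have := h.convex ε hε (i + 1)
    rw [add_right_comm i 1 2] at this
    exact this
  conformal ε hε := (h.conformal ε hε).shift

theorem of_left_right (h : IsLagrangianQuadrilateral f p x w ζ) (h02 : p 0 < p 2)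
    (h13 : p 1 < p 3) :
    ∃ l : ℝ, 0 < l ∧ IsInteriorEdgeLength f p l ∧
      (fun ε => Real.log (ζ ε)) ~[𝓝[>] (0 : ℝ)] (fun ε => -(Real.pi * l / ε)) := by
  choose a b hf using h.affine
  have hderiv : ∀ i t, deriv (f i) t = a i * t + b i := fun i t => (hf i t).deriv
  have hL : ∀ ε i, lagrangian (f i) ε = thinLine a b ε i := fun ε i => by
    ext z; simp only [lagrangian, thinLine, hderiv]
  have hmeet : ∀ i, a (i + 1) * p i + b (i + 1) = a i * p i + b i := fun i => by
    have h1 := ((hf (i + 1) (p i)).sub (hf i (p i))).deriv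
    have h2 := h.critical i
    have h3 : deriv (f (i + 1) - f i) (p i) = 0 := h2
    rw [h1] at h3
    linarith
  have him : ∀ ε > 0, ∀ i, (x ε i).im = ε * (a i * (x ε i).re + b i) ∧
      (x ε i).im = ε * (a (i + 1) * (x ε i).re + b (i + 1)) := fun ε hε i => by
    have := h.vertex ε hε i
    rw [hL, hL] at this
    exact this
  have hcross : ∀ ε > 0, ∀ i, 0 < ((x ε (i + 1)).re - (x ε i).re) *
      ((x ε (i + 2)).re - (x ε (i + 1)).re) * (a (i + 2) - a (i + 1)) := fun ε hε i => by
    have hc := h.convex ε hε i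
    have e0 := (him ε hε i).2
    have e1 := (him ε hε (i + 1)).1
    have e1' := (him ε hε (i + 1)).2
    have e2 := (him ε hε (i + 2)).1
    rw [show i + 1 + 1 = i + 2 by rw [add_assoc]; rfl] at e1'
    refine pos_of_mul_pos_right (a := ε) (lt_of_lt_of_eq hc ?_) hε.le
    simp only [Complex.sub_re, Complex.sub_im]
    linear_combination ((x ε (i + 1)).re - (x ε i).re) * (e2 - e1') -
      ((x ε (i + 2)).re - (x ε (i + 1)).re) * (e1 - e0)
  have hslope : ∀ i, a (i + 1) - a i ≠ 0 := fun i e => by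
    have := hcross 1 one_pos (i + 3)
    have e1 : i + 3 + 1 = i := by fin_cases i <;> rfl
    have e2 : i + 3 + 2 = i + 1 := by fin_cases i <;> rfl
    rw [e2, e1, e, mul_zero] at this
    exact lt_irrefl _ this
  have hre : ∀ ε > 0, ∀ i, (x ε i).re = p i := fun ε hε i => by
    have h1 := mul_left_cancel₀ (ne_of_gt hε) ((him ε hε i).1.symm.trans (him ε hε i).2)
    have h2 : (a (i + 1) - a i) * ((x ε i).re - p i) = 0 := by linear_combination -h1 - hmeet i
    exact sub_eq_zero.1 ((mul_eq_zero.1 h2).resolve_left (hslope i))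
  have hx : ∀ ε > 0, x ε = thinVertex a b p ε := fun ε hε => by
    funext i
    refine Complex.ext (hre ε hε i) ?_
    rw [(him ε hε i).1, hre ε hε i]
    rfl
  have hq : IsLeftRightQuadrilateral a b p :=
    { meet := hmeet
      turn := fun i => by simpa only [hre 1 one_pos] using hcross 1 one_pos i
      lt_zero_two := h02
      lt_one_three := h13 }
  have hlim := hq.tendsto_mul_log (ζ := ζ) (w := w) fun ε hε => by
    have := h.conformal ε hε
    simp only [hL] at this
    rwa [hx ε hε] at this
  have hlpos := hq.integral_inv_gap_pos
  refine ⟨_, hlpos, hq.isInteriorEdgeLength hf, ?_⟩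
  set l := ∫ x in max (p 0) (p 1)..min (p 2) (p 3), 1 / gap a b x
  have hpl : Real.pi * l ≠ 0 := (mul_pos Real.pi_pos hlpos).ne'
  refine (Asymptotics.isEquivalent_iff_tendsto_one ?_).2 ?_
  · filter_upwards [self_mem_nhdsWithin] with ε hε
    exact neg_ne_zero.2 (div_ne_zero hpl (ne_of_gt hε))
  · have h1 := hlim.div_const (-(Real.pi * l))
    rw [div_self (neg_ne_zero.2 hpl)] at h1
    refine h1.congr' ?_
    filter_upwards [self_mem_nhdsWithin] with ε hε
    have hε0 : ε ≠ 0 := ne_of_gt hε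
    rw [Pi.div_apply]
    field_simp

theorem of_mul_pos (h : IsLagrangianQuadrilateral f p x w ζ)
    (hp : 0 < (p 2 - p 0) * (p 3 - p 1)) :
    ∃ l : ℝ, 0 < l ∧ IsInteriorEdgeLength f p l ∧
      (fun ε => Real.log (ζ ε)) ~[𝓝[>] (0 : ℝ)] (fun ε => -(Real.pi * l / ε)) := by
  rcases pos_and_pos_or_neg_and_neg_of_mul_pos hp with ⟨h1, h2⟩ | ⟨h1, h2⟩
  · exact h.of_left_right (sub_pos.1 h1) (sub_pos.1 h2)
  · obtain ⟨l, hl, htree, hlog⟩ := h.reflect.of_left_right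
      (neg_lt_neg (sub_neg.1 h1)) (neg_lt_neg (sub_neg.1 h2))
    exact ⟨l, hl, htree.of_reflect, hlog⟩

end IsLagrangianQuadrilateral

theorem lemma4p9
    (f : Fin 4 → ℝ → ℝ) (hf : ∀ i, HasAffineDerivative (f i))
    (hgen : ∀ ε : ℝ, 0 < ε → ∀ i j : Fin 4, i ≠ j →
      (lagrangian (f i) ε ∩ lagrangian (f j) ε).Nonempty ∧
        lagrangian (f i) ε ≠ lagrangian (f j) ε)
    (p : Fin 4 → ℝ) (hp : ∀ i, deriv (fun q => f (i + 1) q - f i q) (p i) = 0)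
    (x : ℝ → Fin 4 → ℂ)
    (hx : ∀ ε : ℝ, 0 < ε → ∀ i, x ε i ∈ lagrangian (f i) ε ∩ lagrangian (f (i + 1)) ε)
    (hconv : ∀ ε : ℝ, 0 < ε → IsConvexQuadrilateralCCW (x ε))
    (w : ℝ → ℂ → ℂ) (z₄ : ℝ → ℝ)
    (hw : ∀ ε : ℝ, 0 < ε →
      IsSchwarzChristoffelMap (fun i => lagrangian (f i) ε) (x ε) (z₄ ε) (w ε)) :
    (0 < (p 2 - p 0) * (p 3 - p 1) →
      ∃ l : ℝ, 0 < l ∧ IsInteriorEdgeLength f p l ∧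
        (fun ε => Real.log (z₄ ε)) ~[𝓝[>] (0 : ℝ)] (fun ε => -(Real.pi * l / ε))) ∧
    ((p 2 - p 0) * (p 3 - p 1) < 0 →
      ∃ l : ℝ, 0 < l ∧ IsInteriorEdgeLength f p l ∧
        (fun ε => Real.log (1 - z₄ ε)) ~[𝓝[>] (0 : ℝ)] (fun ε => -(Real.pi * l / ε))) := by
  have h : IsLagrangianQuadrilateral f p x w z₄ := ⟨hf, hp, hx, hconv, hw⟩
  refine ⟨h.of_mul_pos, fun hneg => ?_⟩
  obtain ⟨l, hl, htree, hlog⟩ := h.shift.of_mul_pos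
    (show 0 < (p 3 - p 1) * (p 0 - p 2) by linarith)
  exact ⟨l, hl, htree.of_shift, hlog⟩
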